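/- Let $n,p,N$ be positive integers with $2\le p\le N+1$, let $t_0<t_1<\dots<t_N$ be real numbers, and put $t_{-1}:=-\infty$, $t_{N+1}:=\infty$, $\mathbb{T}:=[-\pi,\pi]$. Write points of $\mathbb{R}^{n+1}$ as $(t,y)$ with $t\in\mathbb{R}$, $y\in\mathbb{R}^n$. Let $\mathcal{B}_p$ be the space of all functions $F:\mathbb{R}^{n+1}\to\mathbb{C}$ of class $C^p$ that are $2\pi$-periodic in each of the last $n$ variables and satisfy $\partial^\alpha F\in L^2(\mathbb{R}\times\mathbb{T}^n)$ for every multi-index $\alpha\in\mathbb{Z}_+^{n+1}$ with $|\alpha|=p$, with the semi-inner product $$\langle F,G\rangle_{\mathcal{B}_p}:=\int_{\mathbb{R}\times\mathbb{T}^n}\sum_{|\alpha|=p}\frac{p!}{\alpha!}\,\partial^\alpha F\,\overline{\partial^\alpha G}\,dt\,dy .$$ A Beppo Levi polyspline of order $p$ (for the knots $t_0,\dots,t_N$) is a function $S:\mathbb{R}^{n+1}\to\mathbb{C}$ such that (i) $S\in C^{2p-2}(\mathbb{R}^{n+1})$; (ii) for each $j\in\{0,1,\dots,N+1\}$, $S$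 is polyharmonic of order $p$ on the open strip $\Omega_j:=\{(t,y):t_{j-1}<t<t_j\}$, i.e. $S$ is of class $C^{2p}$ and $\Delta^pS=0$ there; (iii) $S$ is $2\pi$-periodic in each of its last $n$ variables; (iv) $\partial^\alpha S\in L^2(\mathbb{R}\times\mathbb{T}^n)$ for all $|\alpha|=p$. Theorem. Let $S$ be any Beppo Levi polyspline of order $p$, and let $G\in\mathcal{B}_p$ satisfy $G(t_j,y)=0$ for all $j\in\{0,1,\dots,N\}$ and all $y\in\mathbb{T}^n$. Then $$\langle S,G\rangle_{\mathcal{B}_p}=0 .$$ -/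

import Mathlib

open MeasureTheory

/-- The space `ℝ^{n+1}` of points `(t, y)`; the coordinate `0` is `t ∈ ℝ`, the coordinates
`1, …, n` are `y ∈ ℝⁿ`. -/
abbrev PointSpace (n : ℕ) : Type := EuclideanSpace ℝ (Fin (n + 1))

/-- The set `ℝ × 𝕋ⁿ` with `𝕋 = [-π, π]`. -/
def torusCylinder (n : ℕ) : Set (PointSpace n) :=
  {x | ∀ i : Fin n, x i.succ ∈ Set.Icc (-Real.pi) Real.pi}

/-- The first order partial derivative `∂F/∂x_i`. -/
noncomputable def partialDeriv {n : ℕ} (i : Fin (n + 1)) (F : PointSpace n → ℂ) :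
    PointSpace n → ℂ :=
  fun x => fderiv ℝ F x (EuclideanSpace.single i 1)

/-- The partial derivative `∂^α F = ∂_0^{α_0} ∂_1^{α_1} ⋯ ∂_n^{α_n} F`. -/
noncomputable def multiDeriv {n : ℕ} (α : Fin (n + 1) → ℕ) (F : PointSpace n → ℂ) :
    PointSpace n → ℂ :=
  (List.finRange (n + 1)).foldr (fun i g => (partialDeriv i)^[α i] g) F

/-- The finite set of all multi-indices `α ∈ ℤ₊^{n+1}` with `|α| = p`. -/
def multiIndices (n p : ℕ) : Finset (Fin (n + 1) → ℕ) :=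
  Finset.piAntidiag Finset.univ p

/-- `F` is `2π`-periodic in each of its last `n` variables. -/
def PeriodicInY {n : ℕ} (F : PointSpace n → ℂ) : Prop :=
  ∀ i : Fin n, Function.Periodic F (EuclideanSpace.single i.succ (2 * Real.pi))

/-- The Beppo Levi conditions: `∂^α F ∈ L²(ℝ × 𝕋ⁿ)` for all `|α| = p`. -/
def BeppoLeviCondition {n : ℕ} (p : ℕ) (F : PointSpace n → ℂ) : Prop :=
  ∀ α ∈ multiIndices n p, MemLp (multiDeriv α F) 2 (volume.restrict (torusCylinder n))

/-- Membership in the space `𝓑_p = 𝓑_p(ℝ × 𝕋ⁿ)`. -/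
structure MemBeppoLevi {n : ℕ} (p : ℕ) (F : PointSpace n → ℂ) : Prop where
  contDiff : ContDiff ℝ p F
  periodic : PeriodicInY F
  memLp : BeppoLeviCondition p F

/-- The integrand `∑_{|α| = p} (p! / α!) ∂^α F · conj (∂^α G)`. -/
noncomputable def beppoLeviIntegrand {n : ℕ} (p : ℕ) (F G : PointSpace n → ℂ)
    (x : PointSpace n) : ℂ :=
  ∑ α ∈ multiIndices n p, ((p.factorial : ℂ) / ((∏ i, (α i).factorial : ℕ) : ℂ)) *
    (multiDeriv α F x * (starRingEnd ℂ) (multiDeriv α G x))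

/-- The semi-inner product `⟨F, G⟩` of the space `𝓑_p`. -/
noncomputable def beppoLeviInner {n : ℕ} (p : ℕ) (F G : PointSpace n → ℂ) : ℂ :=
  ∫ x in torusCylinder n, beppoLeviIntegrand p F G x

/-- The integral in the semi-inner product converges absolutely on `𝓑_p`. -/
theorem integrableOn_beppoLeviIntegrand {n p : ℕ} {F G : PointSpace n → ℂ}
    (hF : MemBeppoLevi p F) (hG : MemBeppoLevi p G) :
    IntegrableOn (beppoLeviIntegrand p F G) (torusCylinder n) := by
  refine integrable_finsetSum _ fun α hα => Integrable.const_mul ?_ _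
  exact (hF.memLp α hα).integrable_mul (hG.memLp α hα).star

/-- The open strip `Ω_j = {(s, y) : t_{j-1} < s < t_j}`, `j ∈ {0, …, N+1}`, determined by the knots
`t_0 < ⋯ < t_N`, where `t_{-1} = -∞` and `t_{N+1} = ∞`: the first coordinate lies above all knots
of index `< j` and below all knots of index `≥ j`. -/
def openStrip {n N : ℕ} (t : Fin (N + 1) → ℝ) (j : Fin (N + 2)) : Set (PointSpace n) :=
  {x | ∀ i : Fin (N + 1), (i.castSucc < j → t i < x 0) ∧ (j ≤ i.castSucc → x 0 < t i)}

/-- `F` is polyharmonic of order `p` on the open set `U`: it is of class `C^{2p}` there and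
`Δ^p F = 0` on `U`. -/
def PolyharmonicOn {n : ℕ} (p : ℕ) (F : PointSpace n → ℂ) (U : Set (PointSpace n)) : Prop :=
  ContDiffOn ℝ (2 * p : ℕ) F U ∧
    ∀ x ∈ U, (fun H : PointSpace n → ℂ => Laplacian.laplacian H)^[p] F x = 0

/-- Beppo Levi polysplines of order `p` on strips determined by the knots `t_0 < ⋯ < t_N`. -/
structure IsBeppoLeviPolyspline {n N : ℕ} (p : ℕ) (t : Fin (N + 1) → ℝ)
    (S : PointSpace n → ℂ) : Prop where
  contDiff : ContDiff ℝ (2 * p - 2 : ℕ) S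
  polyharmonic : ∀ j : Fin (N + 2), PolyharmonicOn p S (openStrip t j)
  periodic : PeriodicInY S
  memLp : BeppoLeviCondition p S

/-- Beppo Levi polysplines of order `p ≥ 2` belong to `𝓑_p`. -/
theorem IsBeppoLeviPolyspline.memBeppoLevi {n N p : ℕ} {t : Fin (N + 1) → ℝ}
    {S : PointSpace n → ℂ} (hp : 2 ≤ p) (hS : IsBeppoLeviPolyspline p t S) :
    MemBeppoLevi p S where
  contDiff := hS.contDiff.of_le (by exact_mod_cast (by omega : p ≤ 2 * p - 2))
  periodic := hS.periodic
  memLp := hS.memLp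

/-! Expand in Fourier series in the periodic variables. Let `c = |k|²`, and let `f`, `g` be the
`k`-th coefficient of `S` and the conjugate of the `k`-th coefficient of `G`. Parseval for each
`∂^α`, followed by the multinomial theorem for `(X + k₁² + ⋯ + kₙ²)^p`, shows that `(2π)ⁿ ⟨S, G⟩` is
the sum over `k` of `∫ ∑_j (p choose j) c^{p-j} f^{(j)} g^{(j)}` (`MemBeppoLevi.hasSum_inner`). It
remains to see that each of these integrals is zero.

Write `L = D² - c`. Polyharmonicity on the strips gives `L^p f = 0` off the knots, while `f` is of
class `C^{2p-2}` throughout (`IsBeppoLeviPolyspline.isExponentialSpline`). If `g` has compact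
support, integration by parts turns the integral into `± ∫ h · L g` with `h = L^{p-1} f`
(`integral_energyDensity`). Here `h` is continuous everywhere and solves `h'' = c h` between knots.
Green's formula on each piece leaves boundary terms `h g' - h' g`. The terms `h g'` telescope
because `h` and `g'` are continuous; the terms `h' g`, where `h'` may jump, vanish because `g` is
zero at the knots (`integral_mul_helmholtz_of_knots`).

Compact support is removed in two ways. For `k ≠ 0`, dividing by a power of a nonzero `k_i` puts
every derivative of order at most `p` of both modes in `L²`, so cutoffs and dominated convergence
suffice. For `k = 0` only the top derivatives are known to be in `L²`; but then the integrand is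
`f^{(p)} g^{(p)}`, and beyond the outermost knots `f^{(p)}` is a polynomial in `L²`, hence zero, so
one cutoff of `g` leaves the integral unchanged. -/

/-! ### The one-variable energy and integration by parts -/

open Polynomial in
/-- The linear functional on polynomials that sends `X ^ j` to `w j`. -/
noncomputable def momentFunctional (w : ℕ → ℂ) : ℂ[X] →ₗ[ℂ] ℂ :=
  Polynomial.lsum fun j => w j • LinearMap.id

namespace momentFunctional
open Polynomial

theorem eq_sum (w : ℕ → ℂ) (P : ℂ[X]) {n : ℕ} (hn : P.natDegree < n) :
    momentFunctional w P = ∑ j ∈ Finset.range n, P.coeff j * w j := by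
  rw [momentFunctional, lsum_apply, sum_over_range' _ _ _ hn]
  · simp [mul_comm]
  · simp

theorem C_mul_X_pow (w : ℕ → ℂ) (a : ℂ) (j : ℕ) :
    momentFunctional w (C a * X ^ j) = a * w j := by
  rw [C_mul_X_pow_eq_monomial, momentFunctional, lsum_apply, sum_monomial_index]
  · simp [mul_comm]
  · simp

/-- Multiplication by `X` acts as the shift on moments. With `(X + c)^{q+1} = X (X + c)^q + c (X +
c)^q` this gives the recursion of the energy in its order, with no binomial identities. -/
theorem X_mul (w : ℕ → ℂ) (P : ℂ[X]) :
    momentFunctional w (X * P) = momentFunctional (fun j => w (j + 1)) P := by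
  induction P using Polynomial.induction_on' with
  | add p q hp hq => rw [mul_add, map_add, map_add, hp, hq]
  | monomial n a =>
    rw [← C_mul_X_pow_eq_monomial, C_mul_X_pow,
      show (X * (C a * X ^ n) : ℂ[X]) = C a * X ^ (n + 1) by ring, C_mul_X_pow]

theorem C_mul (w : ℕ → ℂ) (a : ℂ) (P : ℂ[X]) :
    momentFunctional w (C a * P) = a * momentFunctional w P := by
  rw [← smul_eq_C_mul, map_smul, smul_eq_mul]

end momentFunctional

theorem natDegree_X_add_C_pow_lt (c : ℂ) (q : ℕ) :
    ((Polynomial.X + Polynomial.C c) ^ q).natDegree < q + 1 := by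
  simp [Polynomial.natDegree_pow]

/-- The density `∑_j (p choose j) c^{p-j} f^{(j)} g^{(j)}`. -/
noncomputable def energyDensity (c : ℂ) (p : ℕ) (f g : ℝ → ℂ) (t : ℝ) : ℂ :=
  momentFunctional (fun j => iteratedDeriv j f t * iteratedDeriv j g t)
    ((Polynomial.X + Polynomial.C c) ^ p)

/-- The operator `f ↦ f'' - c f`. -/
noncomputable def helmholtz (c : ℂ) (f : ℝ → ℂ) : ℝ → ℂ :=
  fun t => iteratedDeriv 2 f t - c * f t

theorem energyDensity_eq_sum (c : ℂ) (p : ℕ) (f g : ℝ → ℂ) (t : ℝ) :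
    energyDensity c p f g t = ∑ j ∈ Finset.range (p + 1),
      ((Polynomial.X + Polynomial.C c) ^ p).coeff j *
        (iteratedDeriv j f t * iteratedDeriv j g t) :=
  momentFunctional.eq_sum _ _ (natDegree_X_add_C_pow_lt c p)

theorem HasCompactSupport.iteratedDeriv {g : ℝ → ℂ} (hg : HasCompactSupport g) (j : ℕ) :
    HasCompactSupport (iteratedDeriv j g) := by
  induction j with
  | zero => simpa using hg
  | succ j ih => rw [iteratedDeriv_succ]; exact ih.deriv

theorem continuous_energyDensity {c : ℂ} {p : ℕ} {f g : ℝ → ℂ} (hf : ContDiff ℝ p f)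
    (hg : ContDiff ℝ p g) : Continuous (energyDensity c p f g) := by
  simp only [funext (energyDensity_eq_sum c p f g)]
  refine continuous_finsetSum _ fun j hj => continuous_const.mul ?_
  have hj' : (j : WithTop ℕ∞) ≤ p := by
    exact_mod_cast Nat.lt_succ_iff.mp (Finset.mem_range.mp hj)
  exact (hf.continuous_iteratedDeriv j hj').mul (hg.continuous_iteratedDeriv j hj')

theorem hasCompactSupport_energyDensity {c : ℂ} {p : ℕ} {f g : ℝ → ℂ}
    (hg : HasCompactSupport g) : HasCompactSupport (energyDensity c p f g) := by
  refine HasCompactSupport.intro hg.isCompact fun t ht => ?_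
  rw [energyDensity_eq_sum]
  refine Finset.sum_eq_zero fun j _ => ?_
  have : iteratedDeriv j g t = 0 := by
    have h : g =ᶠ[nhds t] fun _ => (0 : ℂ) :=
      notMem_tsupport_iff_eventuallyEq.mp ht
    rw [h.iteratedDeriv_eq]
    simp
  simp [this]

theorem integrable_energyDensity {c : ℂ} {p : ℕ} {f g : ℝ → ℂ} (hf : ContDiff ℝ p f)
    (hg : ContDiff ℝ p g) (hs : HasCompactSupport g) : Integrable (energyDensity c p f g) :=
  (continuous_energyDensity hf hg).integrable_of_hasCompactSupport
    (hasCompactSupport_energyDensity hs)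

theorem hasDerivAt_iteratedDeriv {f : ℝ → ℂ} {n : WithTop ℕ∞} (hf : ContDiff ℝ n f) {j : ℕ}
    (hj : (j : WithTop ℕ∞) < n) (t : ℝ) :
    HasDerivAt (iteratedDeriv j f) (iteratedDeriv (j + 1) f t) t := by
  rw [iteratedDeriv_succ]
  exact (hf.differentiable_iteratedDeriv j hj t).hasDerivAt

theorem iteratedDeriv_iteratedDeriv (i j : ℕ) (f : ℝ → ℂ) :
    iteratedDeriv i (iteratedDeriv j f) = iteratedDeriv (i + j) f := by
  rw [iteratedDeriv_eq_iterate, iteratedDeriv_eq_iterate, iteratedDeriv_eq_iterate,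
    Function.iterate_add_apply]

theorem ContDiff.iteratedDeriv_add {m j : ℕ} {f : ℝ → ℂ} (hf : ContDiff ℝ (m + j : ℕ) f) :
    ContDiff ℝ m (iteratedDeriv j f) := by
  induction j generalizing f with
  | zero => simpa using hf
  | succ j ih =>
    rw [iteratedDeriv_succ']
    refine ih ?_
    have : ContDiff ℝ ((m + j : ℕ) + 1) f := by exact_mod_cast hf
    exact (contDiff_succ_iff_deriv.mp this).2.2

theorem contDiff_helmholtz {c : ℂ} {m : ℕ} {f : ℝ → ℂ} (hf : ContDiff ℝ (m + 2 : ℕ) f) :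
    ContDiff ℝ m (helmholtz c f) :=
  hf.iteratedDeriv_add.sub (contDiff_const.mul (hf.of_le (by exact_mod_cast (by omega))))

theorem iteratedDeriv_helmholtz {c : ℂ} {j : ℕ} {f : ℝ → ℂ} (hf : ContDiff ℝ (j + 2 : ℕ) f)
    (t : ℝ) : iteratedDeriv j (helmholtz c f) t =
      iteratedDeriv (j + 2) f t - c * iteratedDeriv j f t := by
  have h1 : ContDiff ℝ j f := hf.of_le (by exact_mod_cast (by omega))
  have h2 := hf.iteratedDeriv_add
  unfold helmholtz
  rw [iteratedDeriv_fun_sub h2.contDiffAt (contDiff_const.mul h1).contDiffAt,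
    iteratedDeriv_iteratedDeriv, iteratedDeriv_const_mul_field]

/-- The sum of the two integrands is the derivative of `∑ a_j f^{(j+1)} g^{(j)}`, which is
integrable because `g` has compact support. One order is moved off `g`, at the price of two
derivatives of `f`. -/
theorem integral_energyDensity_succ {c : ℂ} {q : ℕ} {f g : ℝ → ℂ}
    (hf : ContDiff ℝ (q + 2 : ℕ) f) (hg : ContDiff ℝ (q + 1 : ℕ) g)
    (hs : HasCompactSupport g) :
    ∫ t, energyDensity c (q + 1) f g t = -∫ t, energyDensity c q (helmholtz c f) g t := by
  have hf1 : ContDiff ℝ (q + 1 : ℕ) f := hf.of_le (by exact_mod_cast (by omega))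
  have hg0 : ContDiff ℝ q g := hg.of_le (by exact_mod_cast (by omega))
  have i1 := integrable_energyDensity (c := c) hf1 hg hs
  have i2 := integrable_energyDensity (c := c) (contDiff_helmholtz (c := c) hf) hg0 hs
  set a := fun j => ((Polynomial.X + Polynomial.C c) ^ q).coeff j with ha
  let Φ : ℝ → ℂ := fun t => ∑ j ∈ Finset.range (q + 1),
    a j * (iteratedDeriv (j + 1) f t * iteratedDeriv j g t)
  have key : ∀ t, HasDerivAt Φ
      (energyDensity c (q + 1) f g t + energyDensity c q (helmholtz c f) g t) t := by
    intro t
    have e1 : energyDensity c (q + 1) f g t = ∑ j ∈ Finset.range (q + 1), (a j *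
        (iteratedDeriv (j + 1) f t * iteratedDeriv (j + 1) g t) +
        c * (a j * (iteratedDeriv j f t * iteratedDeriv j g t))) := by
      rw [energyDensity, pow_succ', add_mul, map_add, momentFunctional.X_mul,
        momentFunctional.C_mul, momentFunctional.eq_sum _ _ (natDegree_X_add_C_pow_lt c q),
        momentFunctional.eq_sum _ _ (natDegree_X_add_C_pow_lt c q), Finset.mul_sum,
        ← Finset.sum_add_distrib]
    rw [e1, energyDensity_eq_sum, ← Finset.sum_add_distrib]
    refine HasDerivAt.fun_sum fun j hj => ?_
    have hj' : j ≤ q := Nat.lt_succ_iff.mp (Finset.mem_range.mp hj)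
    rw [iteratedDeriv_helmholtz (hf.of_le (by exact_mod_cast (by omega)))]
    have d1 := hasDerivAt_iteratedDeriv hf (j := j + 1) (by exact_mod_cast (by omega)) t
    have d2 := hasDerivAt_iteratedDeriv hg (j := j) (by exact_mod_cast (by omega)) t
    refine ((d1.fun_mul d2).const_mul (a j)).congr_deriv ?_
    simp only [ha]
    ring
  have hΦ : Integrable Φ := by
    refine integrable_finsetSum _ fun j hj => Integrable.const_mul ?_ _
    have hj' : j ≤ q := Nat.lt_succ_iff.mp (Finset.mem_range.mp hj)
    refine Continuous.integrable_of_hasCompactSupport ?_ ((hs.iteratedDeriv j).mul_left)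
    exact (hf1.continuous_iteratedDeriv _ (by exact_mod_cast (by omega))).mul
      (hg0.continuous_iteratedDeriv _ (by exact_mod_cast hj'))
  have := integral_eq_zero_of_hasDerivAt_of_integrable key (i1.add i2) hΦ
  rw [integral_add i1 i2] at this
  exact eq_neg_of_add_eq_zero_left this

/-- The integrands differ by `c (f g)''`. At this last stage `f` is only `C²`, so the two remaining
orders on `g` stay there and form `g'' - c g`. -/
theorem integral_energyDensity_two {c : ℂ} {f g : ℝ → ℂ}
    (hf : ContDiff ℝ 2 f) (hg : ContDiff ℝ 2 g) (hs : HasCompactSupport g) :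
    ∫ t, energyDensity c 2 f g t = ∫ t, helmholtz c f t * helmholtz c g t := by
  have i1 := integrable_energyDensity (c := c) (p := 2) hf hg hs
  have c1 : Continuous (helmholtz c f) := (contDiff_helmholtz (m := 0) hf).continuous
  have c2 : Continuous (helmholtz c g) := (contDiff_helmholtz (m := 0) hg).continuous
  have hs2 : HasCompactSupport (helmholtz c g) :=
    (hs.iteratedDeriv 2).sub hs.mul_left
  have i2 : Integrable (fun t => helmholtz c f t * helmholtz c g t) :=
    (c1.mul c2).integrable_of_hasCompactSupport hs2.mul_left
  have key : ∀ t, HasDerivAt (fun t => c * (f t * iteratedDeriv 1 g t + iteratedDeriv 1 f t * g t))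
      (energyDensity c 2 f g t - helmholtz c f t * helmholtz c g t) t := by
    intro t
    have f0 := hasDerivAt_iteratedDeriv hf (j := 0) (by norm_num) t
    have f1 := hasDerivAt_iteratedDeriv hf (j := 1) (by norm_num) t
    have g0 := hasDerivAt_iteratedDeriv hg (j := 0) (by norm_num) t
    have g1 := hasDerivAt_iteratedDeriv hg (j := 1) (by norm_num) t
    simp only [iteratedDeriv_zero, zero_add, Nat.reduceAdd] at f0 f1 g0 g1
    have e : energyDensity c 2 f g t = iteratedDeriv 2 f t * iteratedDeriv 2 g t +
        2 * c * (iteratedDeriv 1 f t * iteratedDeriv 1 g t) + c ^ 2 * (f t * g t) := by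
      rw [energyDensity, show ((Polynomial.X + Polynomial.C c) ^ 2 : Polynomial ℂ) =
        Polynomial.C 1 * Polynomial.X ^ 2 + Polynomial.C (2 * c) * Polynomial.X ^ 1 +
        Polynomial.C (c ^ 2) * Polynomial.X ^ 0 by
          simp only [map_mul, map_pow, map_one, map_ofNat]; ring, map_add, map_add,
        momentFunctional.C_mul_X_pow, momentFunctional.C_mul_X_pow, momentFunctional.C_mul_X_pow]
      simp
    rw [e]
    refine (((f0.fun_mul g1).fun_add (f1.fun_mul g0)).const_mul c).congr_deriv ?_
    simp only [helmholtz]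
    ring
  have hΦ : Integrable (fun t => c * (f t * iteratedDeriv 1 g t + iteratedDeriv 1 f t * g t)) := by
    refine Integrable.const_mul (Continuous.integrable_of_hasCompactSupport ?_
      ((hs.iteratedDeriv 1).mul_left.add hs.mul_left)) _
    exact (hf.continuous.mul (hg.continuous_iteratedDeriv 1 (by norm_num))).add
      ((hf.continuous_iteratedDeriv 1 (by norm_num)).mul hg.continuous)
  have := integral_eq_zero_of_hasDerivAt_of_integrable key (i1.sub i2) hΦ
  rw [integral_sub i1 i2] at this
  exact sub_eq_zero.mp this

theorem integral_energyDensity {c : ℂ} {q : ℕ} {f g : ℝ → ℂ}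
    (hf : ContDiff ℝ (2 * q + 2 : ℕ) f) (hg : ContDiff ℝ (q + 2 : ℕ) g)
    (hs : HasCompactSupport g) :
    ∫ t, energyDensity c (q + 2) f g t =
      (-1) ^ q * ∫ t, (helmholtz c)^[q + 1] f t * helmholtz c g t := by
  induction q generalizing f with
  | zero => simpa using integral_energyDensity_two hf hg hs
  | succ q ih =>
    have hf' : ContDiff ℝ (2 * q + 2 + 2 : ℕ) f := hf
    -- Each of the `q` reductions costs `f` two derivatives, so `C^{2q+2}` leaves exactly the `C²`
    -- needed at the base.
    rw [integral_energyDensity_succ (hf.of_le (by exact_mod_cast (by omega))) hg hs,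
      ih (contDiff_helmholtz hf') (hg.of_le (by exact_mod_cast (by omega))),
      Function.iterate_succ_apply _ (q + 1)]
    ring

theorem contDiff_iterate_helmholtz {c : ℂ} {m q : ℕ} {f : ℝ → ℂ}
    (hf : ContDiff ℝ (m + 2 * q : ℕ) f) : ContDiff ℝ m ((helmholtz c)^[q] f) := by
  induction q generalizing f with
  | zero => simpa using hf
  | succ q ih => exact ih (contDiff_helmholtz hf)

/-! ### Green's formula between knots -/

theorem integral_mul_helmholtz_Ioo {c : ℂ} {a b : ℝ} (hab : a < b) {h h' g : ℝ → ℂ}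
    (hc : Continuous h) (h1 : ∀ t ∈ Set.Ioo a b, HasDerivAt h (h' t) t)
    (h2 : ∀ t ∈ Set.Ioo a b, HasDerivAt h' (c * h t) t) (hg : ContDiff ℝ 2 g)
    (ga : g a = 0) (gb : g b = 0) :
    ∫ t in a..b, h t * helmholtz c g t =
      h b * iteratedDeriv 1 g b - h a * iteratedDeriv 1 g a := by
  -- Nothing is known of `h'` at the endpoints. A double primitive `w` of `c h`, corrected by an
  -- affine function, equals `h` on the open interval and is differentiable twice on the whole line.
  let w' : ℝ → ℂ := fun t => ∫ s in a..t, c * h s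
  have hw' : ∀ t, HasDerivAt w' (c * h t) t := fun t =>
    (continuous_const.mul hc).integral_hasStrictDerivAt a t |>.hasDerivAt
  have cw' : Continuous w' := continuous_iff_continuousAt.mpr fun t => (hw' t).continuousAt
  let w : ℝ → ℂ := fun t => ∫ s in a..t, w' s
  have hw : ∀ t, HasDerivAt w (w' t) t := fun t =>
    cw'.integral_hasStrictDerivAt a t |>.hasDerivAt
  obtain ⟨k, hk⟩ := isOpen_Ioo.exists_is_const_of_deriv_eq_zero (s := Set.Ioo a b)
    isPreconnected_Ioo (f := fun t => h' t - w' t)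
    (fun t ht => ((h2 t ht).sub (hw' t)).differentiableAt.differentiableWithinAt)
    (fun t ht => by simpa using ((h2 t ht).fun_sub (hw' t)).deriv)
  have hu : ∀ t, HasDerivAt (fun t : ℝ => w t + t * k) (w' t + k) t := fun t => by
    simpa using (hw t).fun_add ((hasDerivAt_id t).ofReal_comp.mul_const k)
  obtain ⟨d, hd⟩ := isOpen_Ioo.exists_is_const_of_deriv_eq_zero (s := Set.Ioo a b)
    isPreconnected_Ioo (f := fun t => h t - (w t + t * k))
    (fun t ht => ((h1 t ht).sub (hu t)).differentiableAt.differentiableWithinAt)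
    (fun t ht => by
      have := ((h1 t ht).fun_sub (hu t)).deriv
      rw [this, ← hk t ht]
      simp)
  have hu2 : ∀ t, HasDerivAt (fun t : ℝ => w t + t * k + d) (w' t + k) t := fun t =>
    (hu t).add_const d
  -- Continuity of `h` carries the equality to the closed interval, so Green's formula can be
  -- applied up to the endpoints.
  have heq : Set.EqOn h (fun t => w t + t * k + d) (Set.Icc a b) := by
    rw [← closure_Ioo hab.ne]
    refine Set.EqOn.closure (fun t ht => ?_) hc
      (continuous_iff_continuousAt.mpr fun t => (hu2 t).continuousAt)
    rw [← hd t ht]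
    simp
  have hΨ : ∀ t ∈ Set.uIcc a b, HasDerivAt
      (fun t : ℝ => (w t + t * k + d) * iteratedDeriv 1 g t - (w' t + k) * g t)
      (h t * helmholtz c g t) t := by
    intro t ht
    rw [Set.uIcc_of_le hab.le] at ht
    have g0 := hasDerivAt_iteratedDeriv hg (j := 0) (by norm_num) t
    have g1 := hasDerivAt_iteratedDeriv hg (j := 1) (by norm_num) t
    simp only [iteratedDeriv_zero, zero_add, Nat.reduceAdd] at g0 g1
    refine (((hu2 t).fun_mul g1).fun_sub (((hw' t).add_const k).fun_mul g0)).congr_deriv ?_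
    rw [heq ht]
    simp only [helmholtz]
    ring
  rw [intervalIntegral.integral_eq_sub_of_hasDerivAt hΨ, ga, gb,
    heq (Set.left_mem_Icc.mpr hab.le), heq (Set.right_mem_Icc.mpr hab.le)]
  · ring
  · exact (hc.mul (contDiff_helmholtz (m := 0) hg).continuous).intervalIntegrable _ _

/-- Split the interval at a knot inside it: the two copies of `h g'` at the knot cancel, and no
information about `h'` there is used because `g` vanishes. -/
theorem integral_mul_helmholtz_of_knots {c : ℂ} {h h' g : ℝ → ℂ} (hc : Continuous h)
    (hg : ContDiff ℝ 2 g) (K : Finset ℝ) (hK : ∀ x ∈ K, g x = 0) {a b : ℝ} (hab : a < b)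
    (h1 : ∀ t ∈ Set.Ioo a b, t ∉ K → HasDerivAt h (h' t) t)
    (h2 : ∀ t ∈ Set.Ioo a b, t ∉ K → HasDerivAt h' (c * h t) t)
    (ga : g a = 0) (gb : g b = 0) :
    ∫ t in a..b, h t * helmholtz c g t =
      h b * iteratedDeriv 1 g b - h a * iteratedDeriv 1 g a := by
  induction K using Finset.induction_on generalizing a b with
  | empty =>
    exact integral_mul_helmholtz_Ioo hab hc
      (fun t ht => h1 t ht (by simp)) (fun t ht => h2 t ht (by simp)) hg ga gb
  | insert x K hx ih =>
    have hK' : ∀ y ∈ K, g y = 0 := fun y hy => hK y (Finset.mem_insert_of_mem hy)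
    have gx : g x = 0 := hK x (Finset.mem_insert_self x K)
    by_cases hxab : x ∈ Set.Ioo a b
    · have i1 := ih hK' hxab.1
        (fun t ht htK => h1 t ⟨ht.1, ht.2.trans hxab.2⟩ (by simp [htK, ht.2.ne]))
        (fun t ht htK => h2 t ⟨ht.1, ht.2.trans hxab.2⟩ (by simp [htK, ht.2.ne])) ga gx
      have i2 := ih hK' hxab.2
        (fun t ht htK => h1 t ⟨hxab.1.trans ht.1, ht.2⟩ (by simp [htK, ht.1.ne']))
        (fun t ht htK => h2 t ⟨hxab.1.trans ht.1, ht.2⟩ (by simp [htK, ht.1.ne'])) gx gb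
      have hi : ∀ u v, IntervalIntegrable (fun t => h t * helmholtz c g t) volume u v :=
        (hc.mul (contDiff_helmholtz (m := 0) hg).continuous).intervalIntegrable
      rw [← intervalIntegral.integral_add_adjacent_intervals (hi a x) (hi x b), i1, i2]
      ring
    · exact ih hK' hab
        (fun t ht htK => h1 t ht (by
          simp only [Finset.mem_insert, htK, or_false]; rintro rfl; exact hxab ht))
        (fun t ht htK => h2 t ht (by
          simp only [Finset.mem_insert, htK, or_false]; rintro rfl; exact hxab ht)) ga gb

theorem integral_mul_helmholtz_eq_zero {c : ℂ} {h h' g : ℝ → ℂ} (hc : Continuous h)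
    (K : Finset ℝ) (h1 : ∀ t ∉ K, HasDerivAt h (h' t) t)
    (h2 : ∀ t ∉ K, HasDerivAt h' (c * h t) t) (hg : ContDiff ℝ 2 g)
    (hs : HasCompactSupport g) (hK : ∀ x ∈ K, g x = 0) :
    ∫ t, h t * helmholtz c g t = 0 := by
  obtain ⟨R, hR, hsub⟩ := hs.isCompact.isBounded.subset_ball_lt 0 0
  have hz : ∀ t, R ≤ |t| → g =ᶠ[nhds t] fun _ => (0 : ℂ) := fun t ht => by
    refine notMem_tsupport_iff_eventuallyEq.mp fun hmem => ?_
    have := hsub hmem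
    rw [mem_ball_zero_iff, Real.norm_eq_abs] at this
    linarith
  have hzR := hz R (le_abs_self R)
  have hzR' := hz (-R) (by rw [abs_neg]; exact le_abs_self R)
  have key := integral_mul_helmholtz_of_knots hc hg K hK (a := -R) (b := R) (by linarith)
    (fun t _ ht => h1 t ht) (fun t _ ht => h2 t ht) hzR'.self_of_nhds hzR.self_of_nhds
  rw [hzR.iteratedDeriv_eq, hzR'.iteratedDeriv_eq] at key
  rw [intervalIntegral.integral_eq_integral_of_support_subset] at key
  · simpa using key
  · intro t ht
    by_contra hcon
    have hRt : R ≤ |t| := by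
      by_contra hlt
      have := abs_lt.mp (not_le.mp hlt)
      exact hcon ⟨this.1, this.2.le⟩
    refine ht ?_
    simp [helmholtz, (hz t hRt).iteratedDeriv_eq, (hz t hRt).self_of_nhds]

/-- The modes of a polyspline: `f` is of class `C^{2q+2}`, and off the knots `K` the function
`(D² - c)^{q+1} f` is twice differentiable and is annihilated by `D² - c`. -/
structure IsExponentialSpline (c : ℂ) (q : ℕ) (K : Finset ℝ) (f : ℝ → ℂ) : Prop where
  contDiff : ContDiff ℝ (2 * q + 2 : ℕ) f
  ode : ∃ h' : ℝ → ℂ, ∀ t ∉ K, HasDerivAt ((helmholtz c)^[q + 1] f) (h' t) t ∧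
    HasDerivAt h' (c * (helmholtz c)^[q + 1] f t) t

theorem IsExponentialSpline.continuous_iterate {c : ℂ} {q : ℕ} {K : Finset ℝ} {f : ℝ → ℂ}
    (hf : IsExponentialSpline c q K f) : Continuous ((helmholtz c)^[q + 1] f) :=
  (contDiff_iterate_helmholtz (m := 0) (q := q + 1)
    (hf.contDiff.of_le (by exact_mod_cast (by omega)))).continuous

theorem IsExponentialSpline.integral_energyDensity_of_hasCompactSupport {c : ℂ} {q : ℕ}
    {K : Finset ℝ} {f g : ℝ → ℂ} (hf : IsExponentialSpline c q K f)
    (hg : ContDiff ℝ (q + 2 : ℕ) g) (hs : HasCompactSupport g) (hK : ∀ x ∈ K, g x = 0) :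
    ∫ t, energyDensity c (q + 2) f g t = 0 := by
  obtain ⟨h', hh⟩ := hf.ode
  rw [integral_energyDensity hf.contDiff hg hs,
    integral_mul_helmholtz_eq_zero hf.continuous_iterate K (fun t ht => (hh t ht).1)
    (fun t ht => (hh t ht).2) (hg.of_le (by exact_mod_cast (by omega))) hs hK, mul_zero]

/-! ### Cutoffs and the nonzero frequencies -/

/-- A smooth cutoff function on the line, equal to `1` on `[-1, 1]`. -/
noncomputable def unitCutoff (t : ℝ) : ℂ :=
  ((⟨1, 2, one_pos, one_lt_two⟩ : ContDiffBump (0 : ℝ)) t : ℝ)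

theorem contDiff_unitCutoff {n : ℕ} : ContDiff ℝ n unitCutoff :=
  Complex.ofRealCLM.contDiff.comp (ContDiffBump.contDiff _)

theorem hasCompactSupport_unitCutoff : HasCompactSupport unitCutoff :=
  HasCompactSupport.comp_left (g := Complex.ofReal) (ContDiffBump.hasCompactSupport _)
    Complex.ofReal_zero

theorem unitCutoff_eq_one {t : ℝ} (ht : |t| ≤ 1) : unitCutoff t = 1 := by
  rw [unitCutoff, ContDiffBump.one_of_mem_closedBall, Complex.ofReal_one]
  simpa using ht

/-- The cutoff at radius `m + 1`. -/
noncomputable def scaledCutoff (m : ℕ) (t : ℝ) : ℂ := unitCutoff ((m + 1 : ℝ)⁻¹ * t)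

theorem contDiff_scaledCutoff {n : ℕ} (m : ℕ) : ContDiff ℝ n (scaledCutoff m) :=
  contDiff_unitCutoff.comp (contDiff_const.mul contDiff_id)

theorem hasCompactSupport_scaledCutoff (m : ℕ) : HasCompactSupport (scaledCutoff m) :=
  hasCompactSupport_unitCutoff.comp_homeomorph
    (Homeomorph.mulLeft₀ ((m + 1 : ℝ)⁻¹) (by positivity))

theorem scaledCutoff_mul_eventuallyEq (m : ℕ) (g : ℝ → ℂ) {t : ℝ} (ht : |t| < m + 1) :
    (fun s => scaledCutoff m s * g s) =ᶠ[nhds t] g := by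
  filter_upwards [(continuous_abs.tendsto t).eventually_lt_const ht] with s hs
  rw [scaledCutoff, unitCutoff_eq_one, one_mul]
  rw [abs_mul, abs_inv, abs_of_nonneg (by positivity : (0 : ℝ) ≤ m + 1)]
  rw [inv_mul_le_one₀ (by positivity)]
  exact hs.le

/-- The chain rule contributes the factor `(m + 1)^{-j} ≤ 1`, so the bounds of the unit cutoff serve
all scales at once. -/
theorem exists_norm_iteratedDeriv_scaledCutoff_le (p : ℕ) :
    ∃ M : ℝ, 0 ≤ M ∧ ∀ j ≤ p, ∀ (m : ℕ) (t : ℝ),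
      ‖iteratedDeriv j (scaledCutoff m) t‖ ≤ M := by
  have hb : ∀ j, ∃ M : ℝ, ∀ t, ‖iteratedDeriv j unitCutoff t‖ ≤ M := fun j =>
    (hasCompactSupport_unitCutoff.iteratedDeriv j).exists_bound_of_continuous
      ((contDiff_unitCutoff (n := j)).continuous_iteratedDeriv j le_rfl)
  choose M hM using hb
  have hM0 : ∀ j, 0 ≤ M j := fun j => (norm_nonneg _).trans (hM j 0)
  refine ⟨∑ j ∈ Finset.range (p + 1), M j, Finset.sum_nonneg fun j _ => hM0 j,
    fun j hj m t => ?_⟩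
  have e : iteratedDeriv j (scaledCutoff m) t =
      ((m + 1 : ℝ)⁻¹) ^ j • iteratedDeriv j unitCutoff ((m + 1 : ℝ)⁻¹ * t) := by
    have := iteratedDeriv_comp_const_smul (contDiff_unitCutoff (n := j)) ((m + 1 : ℝ)⁻¹)
    exact congrFun this t
  have hle : ((m + 1 : ℝ)⁻¹) ^ j ≤ 1 := by
    refine pow_le_one₀ (by positivity) (inv_le_one_of_one_le₀ ?_)
    have : (0 : ℝ) ≤ m := Nat.cast_nonneg m
    linarith
  rw [e, norm_smul, Real.norm_of_nonneg (by positivity)]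
  calc ((m + 1 : ℝ)⁻¹) ^ j * ‖iteratedDeriv j unitCutoff ((m + 1 : ℝ)⁻¹ * t)‖
      ≤ 1 * M j := mul_le_mul hle (hM j _) (norm_nonneg _) zero_le_one
    _ = M j := one_mul _
    _ ≤ _ := Finset.single_le_sum (f := M) (fun i _ => hM0 i)
      (Finset.mem_range.mpr (Nat.lt_succ_iff.mpr hj))

/-- Leibniz' rule with the uniform cutoff bounds; `D` does not depend on `m`, as dominated
convergence requires. -/
theorem exists_norm_iteratedDeriv_scaledCutoff_mul_le {p : ℕ} {g : ℝ → ℂ}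
    (hg : ContDiff ℝ p g) :
    ∃ D : ℝ, ∀ j ≤ p, ∀ (m : ℕ) (t : ℝ),
      ‖iteratedDeriv j (fun s => scaledCutoff m s * g s) t‖ ≤
        D * ∑ l ∈ Finset.range (p + 1), ‖iteratedDeriv l g t‖ := by
  obtain ⟨M, hM0, hM⟩ := exists_norm_iteratedDeriv_scaledCutoff_le p
  refine ⟨2 ^ p * M, fun j hj m t => ?_⟩
  have h := norm_iteratedFDeriv_mul_le (contDiff_scaledCutoff (n := p) m) hg t (n := j)
    (by exact_mod_cast hj)
  simp only [norm_iteratedFDeriv_eq_norm_iteratedDeriv] at h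
  refine h.trans ?_
  have hS : ∀ i ∈ Finset.range (j + 1), ‖iteratedDeriv (j - i) g t‖ ≤
      ∑ l ∈ Finset.range (p + 1), ‖iteratedDeriv l g t‖ := fun i _ =>
    Finset.single_le_sum (f := fun l => ‖iteratedDeriv l g t‖) (fun _ _ => norm_nonneg _)
      (Finset.mem_range.mpr (by omega))
  have hS0 : 0 ≤ ∑ l ∈ Finset.range (p + 1), ‖iteratedDeriv l g t‖ :=
    Finset.sum_nonneg fun _ _ => norm_nonneg _
  calc _ ≤ ∑ i ∈ Finset.range (j + 1), (j.choose i : ℝ) * M *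
        ∑ l ∈ Finset.range (p + 1), ‖iteratedDeriv l g t‖ := by
        refine Finset.sum_le_sum fun i hi => ?_
        have hi' : i ≤ p := by have := Finset.mem_range.mp hi; omega
        exact mul_le_mul (mul_le_mul_of_nonneg_left (hM i hi' m t) (Nat.cast_nonneg _))
          (hS i hi) (norm_nonneg _) (by positivity)
    _ = 2 ^ j * M * ∑ l ∈ Finset.range (p + 1), ‖iteratedDeriv l g t‖ := by
        rw [← Finset.sum_mul, ← Finset.sum_mul]
        congr 2
        exact_mod_cast Nat.sum_range_choose j
    _ ≤ _ := by gcongr; norm_num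

theorem IsExponentialSpline.integral_energyDensity_of_memLp {c : ℂ} {q : ℕ}
    {K : Finset ℝ} {f g : ℝ → ℂ} (hf : IsExponentialSpline c q K f)
    (hg : ContDiff ℝ (q + 2 : ℕ) g) (hK : ∀ x ∈ K, g x = 0)
    (hf2 : ∀ j ≤ q + 2, MemLp (iteratedDeriv j f) 2)
    (hg2 : ∀ j ≤ q + 2, MemLp (iteratedDeriv j g) 2) :
    ∫ t, energyDensity c (q + 2) f g t = 0 := by
  obtain ⟨D, hD⟩ := exists_norm_iteratedDeriv_scaledCutoff_mul_le hg
  have hf' : ContDiff ℝ (q + 2 : ℕ) f := hf.contDiff.of_le (by exact_mod_cast (by omega))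
  have hgm : ∀ m, ContDiff ℝ (q + 2 : ℕ) (fun s => scaledCutoff m s * g s) := fun m =>
    (contDiff_scaledCutoff m).mul hg
  have hsm : ∀ m, HasCompactSupport (fun s => scaledCutoff m s * g s) := fun m =>
    (hasCompactSupport_scaledCutoff m).mul_right
  -- A combination of products of two `L²` functions, hence integrable. All derivatives up to order
  -- `q + 2`, not just the top one, enter here.
  let bound : ℝ → ℝ := fun t => ∑ j ∈ Finset.range (q + 2 + 1),
    ‖((Polynomial.X + Polynomial.C c) ^ (q + 2)).coeff j‖ * (D *
      ∑ l ∈ Finset.range (q + 2 + 1), ‖iteratedDeriv j f t‖ * ‖iteratedDeriv l g t‖)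
  have hlim : Filter.Tendsto
      (fun m : ℕ => ∫ t, energyDensity c (q + 2) f (fun s => scaledCutoff m s * g s) t)
      Filter.atTop (nhds (∫ t, energyDensity c (q + 2) f g t)) := by
    refine tendsto_integral_of_dominated_convergence bound
      (fun m => (continuous_energyDensity hf' (hgm m)).aestronglyMeasurable) ?_ ?_ ?_
    · refine integrable_finsetSum _ fun j hj => Integrable.const_mul (Integrable.const_mul
        (integrable_finsetSum _ fun l hl => ?_) _) _
      exact (hf2 j (by have := Finset.mem_range.mp hj; omega)).norm.integrable_mul
        (hg2 l (by have := Finset.mem_range.mp hl; omega)).norm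
    · refine fun m => Filter.Eventually.of_forall fun t => ?_
      rw [energyDensity_eq_sum]
      refine (norm_sum_le _ _).trans (Finset.sum_le_sum fun j hj => ?_)
      rw [norm_mul, norm_mul]
      refine mul_le_mul_of_nonneg_left ?_ (norm_nonneg _)
      rw [← Finset.mul_sum, mul_left_comm]
      exact mul_le_mul_of_nonneg_left
        (hD j (by have := Finset.mem_range.mp hj; omega) m t) (norm_nonneg _)
    -- At a fixed point the sequence is eventually constant, since the cutoffs equal `1` near that
    -- point for large `m`.
    · refine Filter.Eventually.of_forall fun t => tendsto_const_nhds.congr' ?_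
      obtain ⟨m₀, hm₀⟩ := exists_nat_gt |t|
      filter_upwards [Filter.eventually_ge_atTop m₀] with m hm
      have hm' : |t| < m + 1 := by
        have : (m₀ : ℝ) ≤ m := by exact_mod_cast hm
        linarith
      rw [energyDensity_eq_sum, energyDensity_eq_sum]
      simp only [(scaledCutoff_mul_eventuallyEq m g hm').iteratedDeriv_eq]
  refine tendsto_nhds_unique hlim (tendsto_const_nhds.congr fun m => ?_)
  refine (hf.integral_energyDensity_of_hasCompactSupport (hgm m) (hsm m) fun x hx => ?_).symm
  rw [hK x hx, mul_zero]

/-! ### The zero frequency -/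

theorem Polynomial.exists_derivative_eq (P : Polynomial ℂ) :
    ∃ Q : Polynomial ℂ, Polynomial.derivative Q = P := by
  induction P using Polynomial.induction_on' with
  | add p q hp hq =>
    obtain ⟨a, rfl⟩ := hp
    obtain ⟨b, rfl⟩ := hq
    exact ⟨a + b, Polynomial.derivative_add⟩
  | monomial n a =>
    refine ⟨Polynomial.monomial (n + 1) (a / (n + 1)), ?_⟩
    rw [Polynomial.derivative_monomial]
    have : (n + 1 : ℂ) ≠ 0 := Nat.cast_add_one_ne_zero n
    congr 1
    push_cast
    field_simp

theorem exists_polynomial_of_iteratedDeriv {I : Set ℝ} (hI : IsOpen I) (hI' : IsPreconnected I)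
    {q : ℕ} {v : ℝ → ℂ} (hv : ContDiff ℝ q v) {P : Polynomial ℂ}
    (hP : ∀ t ∈ I, iteratedDeriv q v t = P.eval (t : ℂ)) :
    ∃ Q : Polynomial ℂ, ∀ t ∈ I, v t = Q.eval (t : ℂ) := by
  induction q generalizing P with
  | zero => exact ⟨P, by simpa using hP⟩
  | succ q ih =>
    obtain ⟨Q, hQ⟩ := Polynomial.exists_derivative_eq P
    have hd : ∀ t ∈ I, HasDerivAt (fun t : ℝ => iteratedDeriv q v t - Q.eval (t : ℂ)) 0 t := by
      intro t ht
      have h1 := hasDerivAt_iteratedDeriv hv (j := q) (by exact_mod_cast Nat.lt_succ_self q) t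
      refine (h1.fun_sub (Q.hasDerivAt (t : ℂ)).comp_ofReal).congr_deriv ?_
      rw [hP t ht, hQ, sub_self]
    obtain ⟨d, hd'⟩ := hI.exists_is_const_of_deriv_eq_zero hI'
      (fun t ht => (hd t ht).differentiableAt.differentiableWithinAt)
      (fun t ht => (hd t ht).deriv)
    refine ih (hv.of_le (by exact_mod_cast Nat.le_succ q)) (P := Q + Polynomial.C d)
      fun t ht => ?_
    rw [Polynomial.eval_add, Polynomial.eval_C, ← hd' t ht]
    ring

/-- A nonzero polynomial has modulus at least some `ε > 0` near infinity, which square integrability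
forbids on a set of infinite measure. The filter `l` lets one proof serve both ends of the line. -/
theorem eq_zero_of_memLp_polynomial {l : Filter ℝ} [l.NeBot] {I : Set ℝ}
    (hI : ∀ s ∈ l, volume (s ∩ I) = ⊤)
    (hl : Filter.Tendsto (fun t : ℝ => ‖(t : ℂ)‖) l Filter.atTop)
    {v : ℝ → ℂ} (hv : MemLp v 2) {P : Polynomial ℂ}
    (hP : ∀ t ∈ I, v t = P.eval (t : ℂ)) : ∀ t ∈ I, v t = 0 := by
  suffices h : P = 0 by intro t ht; rw [hP t ht, h, Polynomial.eval_zero]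
  by_contra hne
  have hbig : ∃ ε : ℝ, 0 < ε ∧ ∀ᶠ t : ℝ in l, ε ≤ ‖P.eval (t : ℂ)‖ := by
    by_cases hdeg : 0 < P.degree
    · exact ⟨1, one_pos, (P.tendsto_norm_atTop hdeg hl).eventually_ge_atTop 1⟩
    · have hC := Polynomial.eq_C_of_degree_le_zero (not_lt.mp hdeg)
      have h0 : P.coeff 0 ≠ 0 := by
        intro h0
        rw [h0, Polynomial.C_0] at hC
        exact hne hC
      refine ⟨‖P.coeff 0‖, norm_pos_iff.mpr h0, Filter.Eventually.of_forall fun t => ?_⟩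
      rw [hC]
      simp
  obtain ⟨ε, hε, hev⟩ := hbig
  have hint : Integrable (fun t => ‖v t‖ ^ 2) := by
    simpa using hv.integrable_norm_pow (by norm_num)
  have hfin := hint.measure_ge_lt_top (ε := ε ^ 2) (by positivity)
  refine (hfin.ne ?_).elim
  refine top_unique ((hI _ hev).symm.le.trans (measure_mono fun t ht => ?_))
  have h2 : ε ≤ ‖v t‖ := by rw [hP t ht.2]; exact ht.1
  exact pow_le_pow_left₀ hε.le h2 2

theorem iterate_helmholtz_zero (r : ℕ) (f : ℝ → ℂ) :
    (helmholtz 0)^[r] f = iteratedDeriv (2 * r) f := by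
  induction r with
  | zero => simp
  | succ r ih =>
    rw [Function.iterate_succ_apply', ih]
    ext t
    rw [helmholtz, iteratedDeriv_iteratedDeriv, zero_mul, sub_zero]
    congr 1
    omega

/-- For `c = 0` the equation makes `f^{(2q+2)}`, the `q`-th derivative of `f^{(q+2)}`, affine on
`I`. Hence `f^{(q+2)}` is a polynomial there, and being in `L²` forces it to vanish. -/
theorem IsExponentialSpline.iteratedDeriv_eq_zero {q : ℕ} {K : Finset ℝ} {f : ℝ → ℂ}
    (hf : IsExponentialSpline 0 q K f) (hf2 : MemLp (iteratedDeriv (q + 2) f) 2)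
    {l : Filter ℝ} [l.NeBot] {I : Set ℝ} (hIo : IsOpen I) (hIp : IsPreconnected I)
    (hIK : ∀ t ∈ I, t ∉ K) (hI : ∀ s ∈ l, volume (s ∩ I) = ⊤)
    (hl : Filter.Tendsto (fun t : ℝ => ‖(t : ℂ)‖) l Filter.atTop) :
    ∀ t ∈ I, iteratedDeriv (q + 2) f t = 0 := by
  obtain ⟨h', hh⟩ := hf.ode
  obtain ⟨k, hk⟩ := hIo.exists_is_const_of_deriv_eq_zero hIp (f := h')
    (fun t ht => (hh t (hIK t ht)).2.differentiableAt.differentiableWithinAt)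
    (fun t ht => by simpa using (hh t (hIK t ht)).2.deriv)
  obtain ⟨d, hd⟩ := hIo.exists_is_const_of_deriv_eq_zero hIp
    (f := fun t : ℝ => (helmholtz 0)^[q + 1] f t - t * k)
    (fun t ht => ((hh t (hIK t ht)).1.fun_sub
      ((hasDerivAt_id t).ofReal_comp.mul_const k)).differentiableAt.differentiableWithinAt)
    (fun t ht => by
      have := ((hh t (hIK t ht)).1.fun_sub
        ((hasDerivAt_id t).ofReal_comp.mul_const k)).deriv
      simpa [hk t ht] using this)
  have hP : ∀ t ∈ I, iteratedDeriv q (iteratedDeriv (q + 2) f) t =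
      (Polynomial.C k * Polynomial.X + Polynomial.C d).eval (t : ℂ) := by
    intro t ht
    have := hd t ht
    rw [iterate_helmholtz_zero] at this
    rw [iteratedDeriv_iteratedDeriv, show q + (q + 2) = 2 * (q + 1) by ring]
    simp only [Polynomial.eval_add, Polynomial.eval_mul, Polynomial.eval_C, Polynomial.eval_X]
    rw [← this]
    ring
  obtain ⟨Q, hQ⟩ := exists_polynomial_of_iteratedDeriv hIo hIp
    (ContDiff.iteratedDeriv_add (m := q) (j := q + 2)
      (hf.contDiff.of_le (by exact_mod_cast (by omega)))) hP
  exact eq_zero_of_memLp_polynomial hI hl hf2 hQ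

theorem energyDensity_zero (p : ℕ) (f g : ℝ → ℂ) (t : ℝ) :
    energyDensity 0 p f g t = iteratedDeriv p f t * iteratedDeriv p g t := by
  have : ((Polynomial.X + Polynomial.C 0) ^ p : Polynomial ℂ) =
      Polynomial.C 1 * Polynomial.X ^ p := by simp
  rw [energyDensity, this, momentFunctional.C_mul_X_pow, one_mul]

theorem IsExponentialSpline.integral_energyDensity_zero_of_memLp {q : ℕ}
    {K : Finset ℝ} {f g : ℝ → ℂ} (hf : IsExponentialSpline 0 q K f)
    (hg : ContDiff ℝ (q + 2 : ℕ) g) (hK : ∀ x ∈ K, g x = 0)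
    (hf2 : MemLp (iteratedDeriv (q + 2) f) 2) :
    ∫ t, energyDensity 0 (q + 2) f g t = 0 := by
  obtain ⟨R, hR⟩ := K.finite_toSet.isBounded.subset_closedBall 0
  have hKR : ∀ x ∈ K, |x| ≤ R := fun x hx => by simpa using hR hx
  have hpos := hf.iteratedDeriv_eq_zero hf2 (l := Filter.atTop) (I := Set.Ioi R) isOpen_Ioi
    isPreconnected_Ioi (fun t ht htK => absurd ((le_abs_self t).trans (hKR t htK)) (not_le.mpr ht))
    (fun s hs => by
      obtain ⟨a, ha⟩ := Filter.mem_atTop_sets.mp hs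
      refine top_unique ((Real.volume_Ioi (a := max a R)).symm.le.trans
        (measure_mono fun t ht => ?_))
      exact ⟨ha t ((le_max_left _ _).trans (Set.mem_Ioi.mp ht).le),
        (le_max_right a R).trans_lt (Set.mem_Ioi.mp ht)⟩)
    (by simpa using Filter.tendsto_abs_atTop_atTop)
  have hneg := hf.iteratedDeriv_eq_zero hf2 (l := Filter.atBot) (I := Set.Iio (-R)) isOpen_Iio
    isPreconnected_Iio (fun t ht htK => by
      have := (neg_abs_le t)
      have := hKR t htK
      have := Set.mem_Iio.mp ht
      linarith)
    (fun s hs => by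
      obtain ⟨a, ha⟩ := Filter.mem_atBot_sets.mp hs
      refine top_unique ((Real.volume_Iio (a := min a (-R))).symm.le.trans
        (measure_mono fun t ht => ?_))
      exact ⟨ha t ((Set.mem_Iio.mp ht).le.trans (min_le_left _ _)),
        (Set.mem_Iio.mp ht).trans_le (min_le_right a (-R))⟩)
    (by simpa using Filter.tendsto_abs_atBot_atTop)
  obtain ⟨m, hm⟩ := exists_nat_gt R
  -- The cutoff changes `g` only where `f^{(q+2)}` is zero, so no integrability of `g` or its
  -- derivatives is needed.
  refine Eq.trans ?_ (hf.integral_energyDensity_of_hasCompactSupport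
    (g := fun s => scaledCutoff m s * g s)
    ((contDiff_scaledCutoff m).mul hg) (hasCompactSupport_scaledCutoff m).mul_right
    fun x hx => by rw [hK x hx, mul_zero])
  refine integral_congr_ae (Filter.Eventually.of_forall fun t => ?_)
  simp only [energyDensity_zero]
  by_cases ht : |t| ≤ R
  · rw [(scaledCutoff_mul_eventuallyEq m g (by linarith)).iteratedDeriv_eq]
  · rcases lt_abs.mp (not_le.mp ht) with h | h
    · rw [hpos t h, zero_mul, zero_mul]
    · rw [hneg t (by simp only [Set.mem_Iio]; linarith), zero_mul, zero_mul]

/-! ### Fourier coefficients in the periodic variables -/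

/-- The linear map that assembles a point of `ℝ^{n+1}` from `t` and `y`. -/
noncomputable def assemblePoint (n : ℕ) : ℝ × (Fin n → ℝ) →L[ℝ] PointSpace n :=
  LinearMap.toContinuousLinearMap
    { toFun := fun z => WithLp.toLp 2 (Fin.cons z.1 z.2)
      map_add' := fun z w => by
        ext j
        refine Fin.cases ?_ (fun i => ?_) j <;> simp
      map_smul' := fun a z => by
        ext j
        refine Fin.cases ?_ (fun i => ?_) j <;> simp }

@[simp] theorem assemblePoint_zero {n : ℕ} (z : ℝ × (Fin n → ℝ)) :
    assemblePoint n z 0 = z.1 := rfl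

@[simp] theorem assemblePoint_succ {n : ℕ} (z : ℝ × (Fin n → ℝ)) (i : Fin n) :
    assemblePoint n z i.succ = z.2 i := rfl

theorem assemblePoint_one_zero (n : ℕ) :
    assemblePoint n (1, 0) = EuclideanSpace.single 0 1 := by
  ext j
  refine Fin.cases ?_ (fun i => ?_) j <;> simp

theorem assemblePoint_zero_single {n : ℕ} (i : Fin n) (a : ℝ) :
    assemblePoint n (0, Pi.single i a) = EuclideanSpace.single i.succ a := by
  ext j
  refine Fin.cases ?_ (fun i => ?_) j
  · simp [Fin.succ_ne_zero]
  · simp [Pi.single_apply]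

/-- The cube `𝕋ⁿ = [-π, π]ⁿ`. -/
def torusBox (n : ℕ) : Set (Fin n → ℝ) := Set.Icc (fun _ => -Real.pi) (fun _ => Real.pi)

theorem isCompact_torusBox (n : ℕ) : IsCompact (torusBox n) := isCompact_Icc

theorem measurableSet_torusBox (n : ℕ) : MeasurableSet (torusBox n) := measurableSet_Icc

/-- The character `y ↦ exp (-i k·y)`. -/
noncomputable def torusChar {n : ℕ} (k : Fin n → ℤ) (y : Fin n → ℝ) : ℂ :=
  Complex.exp (-(Complex.I * ∑ i, (k i : ℂ) * (y i : ℂ)))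

theorem contDiff_torusChar {n : ℕ} (k : Fin n → ℤ) {m : WithTop ℕ∞} :
    ContDiff ℝ m (torusChar k) := by
  unfold torusChar
  refine ContDiff.cexp (contDiff_const.mul (ContDiff.sum fun i _ => contDiff_const.mul ?_)).neg
  exact Complex.ofRealCLM.contDiff.comp (contDiff_apply ℝ ℝ i)

theorem torusChar_add_single {n : ℕ} (k : Fin n → ℤ) (i : Fin n) (s : ℝ) (y : Fin n → ℝ) :
    torusChar k (y + Pi.single i s) = torusChar k y * Complex.exp (-(Complex.I * k i * s)) := by
  rw [torusChar, torusChar, ← Complex.exp_add]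
  congr 1
  have : ∑ j, (k j : ℂ) * ((Pi.single i s : Fin n → ℝ) j : ℂ) = k i * s := by
    rw [Finset.sum_eq_single i]
    · simp
    · intro j _ hj; simp [hj]
    · simp
  simp only [Pi.add_apply, Complex.ofReal_add, mul_add, Finset.sum_add_distrib, this]
  ring

theorem torusChar_periodic {n : ℕ} (k : Fin n → ℤ) (i : Fin n) :
    Function.Periodic (torusChar k) (Pi.single i (2 * Real.pi)) := by
  intro y
  rw [torusChar_add_single]
  have : -(Complex.I * k i * ((2 * Real.pi : ℝ) : ℂ)) =
      ((-k i : ℤ) : ℂ) * (2 * Real.pi * Complex.I) := by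
    push_cast
    ring
  rw [this, Complex.exp_int_mul_two_pi_mul_I, mul_one]

theorem fderiv_torusChar_single {n : ℕ} (k : Fin n → ℤ) (y : Fin n → ℝ) (i : Fin n) :
    fderiv ℝ (torusChar k) y (Pi.single i 1) = -(Complex.I * k i) * torusChar k y := by
  have hd : DifferentiableAt ℝ (torusChar k) y :=
    (contDiff_torusChar k (m := 1)).differentiable (by norm_num) y
  have h1 : HasDerivAt (fun s : ℝ => torusChar k (y + s • Pi.single i 1))
      (fderiv ℝ (torusChar k) y (Pi.single i 1)) 0 := by
    have hl : HasDerivAt (fun s : ℝ => y + s • (Pi.single i 1 : Fin n → ℝ)) (Pi.single i 1) 0 := by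
      simpa using ((hasDerivAt_id (0 : ℝ)).smul_const (Pi.single i 1 : Fin n → ℝ)).const_add y
    have hd' : HasFDerivAt (torusChar k) (fderiv ℝ (torusChar k) y)
        (y + (0 : ℝ) • (Pi.single i 1 : Fin n → ℝ)) := by simpa using hd.hasFDerivAt
    exact hd'.comp_hasDerivAt (0 : ℝ) hl
  have h2 : HasDerivAt (fun s : ℝ => torusChar k y * Complex.exp (-(Complex.I * k i * s)))
      (-(Complex.I * k i) * torusChar k y) 0 := by
    have := (((hasDerivAt_id (0 : ℝ)).ofReal_comp.const_mul (-(Complex.I * k i))).cexp).const_mul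
      (torusChar k y)
    simp only [id, neg_mul] at this
    refine this.congr_deriv ?_
    simp
    ring
  refine h1.unique (h2.congr_of_eventuallyEq (Filter.Eventually.of_forall fun s => ?_))
  have : s • (Pi.single i 1 : Fin n → ℝ) = Pi.single i s := by
    rw [← Pi.single_smul]; simp
  simp only [this, torusChar_add_single]

/-- The Fourier coefficient (up to normalization) in the periodic variables. -/
noncomputable def torusCoeff {n : ℕ} (k : Fin n → ℤ) (F : PointSpace n → ℂ) (t : ℝ) : ℂ :=
  ∫ y in torusBox n, F (assemblePoint n (t, y)) * torusChar k y

/-- The slab of points whose first coordinate lies in `I`. -/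
def slab (n : ℕ) (I : Set ℝ) : Set (PointSpace n) := {x | x 0 ∈ I}

theorem isOpen_slab {n : ℕ} {I : Set ℝ} (hI : IsOpen I) : IsOpen (slab n I) :=
  hI.preimage (by fun_prop : Continuous fun x : PointSpace n => x 0)

theorem ContDiffOn.partialDeriv {n r : ℕ} {U : Set (PointSpace n)} (hU : IsOpen U)
    {F : PointSpace n → ℂ} (hF : ContDiffOn ℝ (r + 1 : ℕ) F U) (i : Fin (n + 1)) :
    ContDiffOn ℝ r (partialDeriv i F) U :=
  (hF.fderiv_of_isOpen hU (by exact_mod_cast le_rfl)).clm_apply contDiffOn_const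

theorem ContDiff.partialDeriv {n r : ℕ} {F : PointSpace n → ℂ}
    (hF : ContDiff ℝ (r + 1 : ℕ) F) (i : Fin (n + 1)) : ContDiff ℝ r (partialDeriv i F) :=
  contDiffOn_univ.mp (hF.contDiffOn.partialDeriv isOpen_univ i)

theorem PeriodicInY.partialDeriv {n : ℕ} {F : PointSpace n → ℂ} (hF : PeriodicInY F)
    (i : Fin (n + 1)) : PeriodicInY (partialDeriv i F) := by
  intro j x
  have : (fun z => F (z + EuclideanSpace.single j.succ (2 * Real.pi))) = F := funext (hF j)
  rw [_root_.partialDeriv, _root_.partialDeriv, ← fderiv_comp_add_right, this]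

/-- Differentiation under the integral, dominated by compactness of a closed ball times the cube. It
is local in `t` because a polyspline has its full smoothness only inside the strips. -/
theorem hasDerivAt_torusCoeff {n : ℕ} (k : Fin n → ℤ) {F : PointSpace n → ℂ} {I : Set ℝ}
    (hI : IsOpen I) (hF : ContDiffOn ℝ 1 F (slab n I)) {t : ℝ} (ht : t ∈ I) :
    HasDerivAt (torusCoeff k F) (torusCoeff k (partialDeriv 0 F) t) t := by
  obtain ⟨δ, hδ, hball⟩ := Metric.nhds_basis_closedBall.mem_iff.mp (hI.mem_nhds ht)
  have hmaps : ∀ {s : ℝ}, s ∈ I → ∀ y, assemblePoint n (s, y) ∈ slab n I := fun hs y => hs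
  have hF' : ContinuousOn (partialDeriv 0 F) (slab n I) :=
    (ContDiffOn.partialDeriv (r := 0) (isOpen_slab hI) (by simpa using hF) 0).continuousOn
  have hcont : ∀ {H : PointSpace n → ℂ}, ContinuousOn H (slab n I) →
      ContinuousOn (fun z : ℝ × (Fin n → ℝ) => H (assemblePoint n z) * torusChar k z.2)
        (Metric.closedBall t δ ×ˢ torusBox n) := fun hH =>
    (hH.comp (assemblePoint n).continuous.continuousOn fun z hz => hball hz.1).mul
      ((contDiff_torusChar k (m := 0)).continuous.comp continuous_snd).continuousOn
  have hcy : ∀ {H : PointSpace n → ℂ}, ContinuousOn H (slab n I) → ∀ s ∈ Metric.closedBall t δ,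
      ContinuousOn (fun y => H (assemblePoint n (s, y)) * torusChar k y) (torusBox n) :=
    fun hH s hs => (hcont hH).comp (f := fun y : Fin n → ℝ => (s, y))
      (by fun_prop) fun y hy => ⟨hs, hy⟩
  obtain ⟨C, hC⟩ := ((isCompact_closedBall t δ).prod
    (isCompact_torusBox n)).exists_bound_of_continuousOn (hcont hF')
  have hmem : Metric.closedBall t δ ∈ nhds t := Metric.closedBall_mem_nhds t hδ
  have htm : t ∈ Metric.closedBall t δ := Metric.mem_closedBall_self hδ.le
  refine (hasDerivAt_integral_of_dominated_loc_of_deriv_le (bound := fun _ => C)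
    (F := fun s y => F (assemblePoint n (s, y)) * torusChar k y)
    (F' := fun s y => partialDeriv 0 F (assemblePoint n (s, y)) * torusChar k y)
    hmem ?_ ?_ ?_ ?_ ?_ ?_).2
  · filter_upwards [hmem] with s hs
    exact (hcy hF.continuousOn s hs).aestronglyMeasurable (measurableSet_torusBox n)
  · exact (hcy hF.continuousOn t htm).integrableOn_compact (isCompact_torusBox n)
  · exact (hcy hF' t htm).aestronglyMeasurable (measurableSet_torusBox n)
  · filter_upwards [ae_restrict_mem (measurableSet_torusBox n)] with y hy s hs
    exact hC (s, y) ⟨hs, hy⟩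
  · exact integrableOn_const (isCompact_torusBox n).measure_lt_top.ne
  · refine Filter.Eventually.of_forall fun y s hs => HasDerivAt.mul_const ?_ _
    have hd : DifferentiableAt ℝ F (assemblePoint n (s, y)) :=
      (hF.differentiableOn (by norm_num)).differentiableAt
        ((isOpen_slab hI).mem_nhds (hmaps (hball hs) y))
    have hl : HasDerivAt (fun s : ℝ => assemblePoint n (s, y)) (EuclideanSpace.single 0 1) s := by
      rw [← assemblePoint_one_zero]
      exact (assemblePoint n).hasFDerivAt.comp_hasDerivAt s
        ((hasDerivAt_id s).prodMk (hasDerivAt_const s y))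
    exact hd.hasFDerivAt.comp_hasDerivAt s hl

theorem integral_fderiv_single_eq_zero {n : ℕ} {H : (Fin n → ℝ) → ℂ} (hH : ContDiff ℝ 1 H)
    (i : Fin n) (hper : Function.Periodic H (Pi.single i (2 * Real.pi))) :
    ∫ y in torusBox n, fderiv ℝ H y (Pi.single i 1) = 0 := by
  cases n with
  | zero => exact i.elim0
  | succ n =>
    have hle : (fun _ : Fin (n + 1) => -Real.pi) ≤ fun _ => Real.pi := fun _ => by
      have := Real.pi_pos
      linarith
    have hfc : Continuous fun y => fderiv ℝ H y (Pi.single i 1) :=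
      (hH.continuous_fderiv (by norm_num)).clm_apply continuous_const
    have hsum : ∀ y : Fin (n + 1) → ℝ, ∑ j, (if j = i then fderiv ℝ H y else 0) (Pi.single j 1) =
        fderiv ℝ H y (Pi.single i 1) := fun y => by
      rw [Finset.sum_eq_single i]
      · simp
      · intro j _ hj; simp [hj]
      · simp
    -- Divergence theorem for the field whose only nonzero component is the `i`-th, equal to `H`;
    -- periodicity cancels the two opposite faces.
    have := integral_divergence_of_hasFDerivAt_off_countable' (fun _ : Fin (n + 1) => -Real.pi)
      (fun _ => Real.pi) hle (fun j y => if j = i then H y else 0)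
      (fun j y => if j = i then fderiv ℝ H y else 0) ∅ Set.countable_empty
      (fun j => by
        by_cases hj : j = i
        · simpa [hj] using hH.continuous.continuousOn
        · simpa [hj] using continuousOn_const)
      (fun y _ j => by
        by_cases hj : j = i
        · simpa [hj] using (hH.differentiable (by norm_num) y).hasFDerivAt
        · simpa [hj] using hasFDerivAt_const (0 : ℂ) y)
      (by
        simp only [hsum]
        exact hfc.continuousOn.integrableOn_compact isCompact_Icc)
    simp only [hsum] at this
    rw [torusBox, this]
    refine Finset.sum_eq_zero fun j _ => ?_
    by_cases hj : j = i
    · subst hj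
      rw [sub_eq_zero]
      refine integral_congr_ae (Filter.Eventually.of_forall fun x => ?_)
      simp only [if_true]
      rw [← hper (j.insertNth (-Real.pi) x)]
      congr 1
      ext l
      refine Fin.succAboveCases j ?_ (fun l => ?_) l
      · simp; ring
      · simp
    · simp [hj]

/-- The derivative of the periodic function `F · torusChar k` integrates to zero, and the product
rule moves the derivative onto the character. -/
theorem torusCoeff_partialDeriv_succ {n : ℕ} (k : Fin n → ℤ) {F : PointSpace n → ℂ} {I : Set ℝ}
    (hI : IsOpen I) (hF : ContDiffOn ℝ 1 F (slab n I)) (hper : PeriodicInY F) {t : ℝ}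
    (ht : t ∈ I) (i : Fin n) :
    torusCoeff k (partialDeriv i.succ F) t = Complex.I * k i * torusCoeff k F t := by
  have hline : ContDiff ℝ 1 fun y : Fin n → ℝ => assemblePoint n (t, y) :=
    (assemblePoint n).contDiff.comp (contDiff_const.prodMk contDiff_id)
  have hG : ContDiff ℝ 1 fun y => F (assemblePoint n (t, y)) :=
    contDiffOn_univ.mp (hF.comp hline.contDiffOn fun y _ => ht)
  have hχ := contDiff_torusChar k (m := 1)
  have hG' : ∀ y, fderiv ℝ (fun y => F (assemblePoint n (t, y))) y (Pi.single i 1) =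
      partialDeriv i.succ F (assemblePoint n (t, y)) := by
    intro y
    have hd : DifferentiableAt ℝ F (assemblePoint n (t, y)) :=
      (hF.differentiableOn (by norm_num)).differentiableAt ((isOpen_slab hI).mem_nhds ht)
    have hl : HasFDerivAt (fun y : Fin n → ℝ => assemblePoint n (t, y))
        ((assemblePoint n).comp (ContinuousLinearMap.inr ℝ ℝ (Fin n → ℝ))) y :=
      (assemblePoint n).hasFDerivAt.comp y (hasFDerivAt_prodMk_right t y)
    have := (hd.hasFDerivAt.comp y hl).fderiv
    simp only [Function.comp_def] at this
    rw [this, partialDeriv, ← assemblePoint_zero_single]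
    rfl
  have hH' : ∀ y, fderiv ℝ (fun y => F (assemblePoint n (t, y)) * torusChar k y) y
      (Pi.single i 1) = partialDeriv i.succ F (assemblePoint n (t, y)) * torusChar k y -
        Complex.I * k i * (F (assemblePoint n (t, y)) * torusChar k y) := by
    intro y
    rw [fderiv_fun_mul (hG.differentiable (by norm_num) y) (hχ.differentiable (by norm_num) y)]
    simp only [add_apply, smul_apply, smul_eq_mul, hG',
      fderiv_torusChar_single]
    ring
  have h0 := integral_fderiv_single_eq_zero (hG.mul hχ) i (fun y => by
    have := hper i (assemblePoint n (t, y))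
    rw [← assemblePoint_zero_single, ← map_add, Prod.mk_add_mk, add_zero] at this
    simp only [this, torusChar_periodic k i y])
  have i1 : IntegrableOn (fun y => F (assemblePoint n (t, y)) * torusChar k y) (torusBox n) :=
    (hG.mul hχ).continuous.continuousOn.integrableOn_compact (isCompact_torusBox n)
  have i2 : IntegrableOn (fun y => partialDeriv i.succ F (assemblePoint n (t, y)) *
      torusChar k y) (torusBox n) := by
    refine Continuous.continuousOn ?_ |>.integrableOn_compact (isCompact_torusBox n)
    simp only [← hG']
    exact ((hG.continuous_fderiv (by norm_num)).clm_apply continuous_const).mul hχ.continuous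
  simp only [hH'] at h0
  rw [integral_sub i2 (i1.const_mul _), integral_const_mul] at h0
  exact sub_eq_zero.mp h0

theorem continuous_torusCoeff {n : ℕ} (k : Fin n → ℤ) {F : PointSpace n → ℂ}
    (hF : Continuous F) : Continuous (torusCoeff k F) := by
  refine continuous_parametric_integral_of_continuous ?_ (isCompact_torusBox n)
  exact (hF.comp (assemblePoint n).continuous).mul
    ((contDiff_torusChar k (m := 0)).continuous.comp continuous_snd)

theorem deriv_torusCoeff {n : ℕ} (k : Fin n → ℤ) {F : PointSpace n → ℂ} (hF : ContDiff ℝ 1 F) :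
    deriv (torusCoeff k F) = torusCoeff k (partialDeriv 0 F) :=
  funext fun t => (hasDerivAt_torusCoeff k isOpen_univ hF.contDiffOn (Set.mem_univ t)).deriv

theorem contDiff_torusCoeff {n r : ℕ} (k : Fin n → ℤ) {F : PointSpace n → ℂ}
    (hF : ContDiff ℝ r F) : ContDiff ℝ r (torusCoeff k F) := by
  induction r generalizing F with
  | zero => exact contDiff_zero.mpr (continuous_torusCoeff k hF.continuous)
  | succ r ih =>
    have h1 : ContDiff ℝ 1 F := hF.of_le (by exact_mod_cast Nat.succ_le_succ (Nat.zero_le r))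
    have : ContDiff ℝ ((r : WithTop ℕ∞) + 1) (torusCoeff k F) := by
      refine contDiff_succ_iff_deriv.mpr ⟨fun t => (hasDerivAt_torusCoeff k isOpen_univ
        h1.contDiffOn (Set.mem_univ t)).differentiableAt, by simp, ?_⟩
      rw [deriv_torusCoeff k h1]
      exact ih (hF.partialDeriv 0)
    exact_mod_cast this

/-! ### Symbols of the derivatives and the multinomial theorem -/

theorem contDiff_iterate_partialDeriv {n r a : ℕ} (i : Fin (n + 1)) {F : PointSpace n → ℂ}
    (hF : ContDiff ℝ (r + a : ℕ) F) : ContDiff ℝ r ((partialDeriv i)^[a] F) := by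
  induction a generalizing F with
  | zero => simpa using hF
  | succ a ih => exact ih (ContDiff.partialDeriv (r := r + a) hF i)

theorem PeriodicInY.iterate_partialDeriv {n : ℕ} {F : PointSpace n → ℂ} (hF : PeriodicInY F)
    (i : Fin (n + 1)) (a : ℕ) : PeriodicInY ((_root_.partialDeriv i)^[a] F) := by
  induction a generalizing F with
  | zero => exact hF
  | succ a ih => exact ih (hF.partialDeriv i)

theorem torusCoeff_iterate_partialDeriv_zero {n a : ℕ} (k : Fin n → ℤ) {F : PointSpace n → ℂ}
    (hF : ContDiff ℝ a F) :
    torusCoeff k ((partialDeriv 0)^[a] F) = iteratedDeriv a (torusCoeff k F) := by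
  induction a generalizing F with
  | zero => simp
  | succ a ih =>
    rw [Function.iterate_succ_apply, ih (hF.partialDeriv 0), iteratedDeriv_succ',
      deriv_torusCoeff k (hF.of_le (by exact_mod_cast Nat.succ_le_succ (Nat.zero_le a)))]

theorem torusCoeff_iterate_partialDeriv_succ {n a : ℕ} (k : Fin n → ℤ) {F : PointSpace n → ℂ}
    (hF : ContDiff ℝ a F) (hper : PeriodicInY F) (i : Fin n) :
    torusCoeff k ((partialDeriv i.succ)^[a] F) =
      fun t => (Complex.I * k i) ^ a * torusCoeff k F t := by
  induction a generalizing F with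
  | zero => simp
  | succ a ih =>
    rw [Function.iterate_succ_apply, ih (hF.partialDeriv i.succ) (hper.partialDeriv i.succ)]
    ext t
    rw [torusCoeff_partialDeriv_succ k isOpen_univ
      (hF.of_le (by exact_mod_cast Nat.succ_le_succ (Nat.zero_le a))).contDiffOn hper
      (Set.mem_univ t)]
    ring

/-- The part of `∂^α` that involves the periodic variables in the list `l`. -/
noncomputable def tangentialDeriv {n : ℕ} (α : Fin n → ℕ) (l : List (Fin n))
    (F : PointSpace n → ℂ) : PointSpace n → ℂ :=
  l.foldr (fun i g => (partialDeriv i.succ)^[α i] g) F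

/-- The fold puts `∂_0` outermost, so the periodic variables can be handled first without commuting
derivatives. -/
theorem multiDeriv_eq {n : ℕ} (α : Fin (n + 1) → ℕ) (F : PointSpace n → ℂ) :
    multiDeriv α F = (partialDeriv 0)^[α 0]
      (tangentialDeriv (fun i => α i.succ) (List.finRange n) F) := by
  rw [multiDeriv, List.finRange_succ, List.foldr_cons, List.foldr_map, tangentialDeriv]

theorem tangentialDeriv_spec {n r : ℕ} (k : Fin n → ℤ) (α : Fin n → ℕ) (l : List (Fin n))
    {F : PointSpace n → ℂ} (hF : ContDiff ℝ (r + (l.map α).sum : ℕ) F) (hper : PeriodicInY F) :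
    ContDiff ℝ r (tangentialDeriv α l F) ∧ PeriodicInY (tangentialDeriv α l F) ∧
      torusCoeff k (tangentialDeriv α l F) =
        fun t => (l.map fun i => (Complex.I * k i) ^ α i).prod * torusCoeff k F t := by
  induction l generalizing r with
  | nil => exact ⟨by simpa [tangentialDeriv] using hF, hper, by simp [tangentialDeriv]⟩
  | cons i l ih =>
    obtain ⟨h1, h2, h3⟩ := ih (r := r + α i)
      (by rwa [List.map_cons, List.sum_cons, ← add_assoc] at hF)
    refine ⟨contDiff_iterate_partialDeriv i.succ h1, h2.iterate_partialDeriv i.succ _, ?_⟩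
    change torusCoeff k ((partialDeriv i.succ)^[α i] (tangentialDeriv α l F)) = _
    rw [torusCoeff_iterate_partialDeriv_succ k (h1.of_le (by exact_mod_cast (by omega))) h2, h3]
    ext t
    rw [List.map_cons, List.prod_cons]
    ring

theorem mem_multiIndices {n p : ℕ} {α : Fin (n + 1) → ℕ} :
    α ∈ multiIndices n p ↔ α 0 + ∑ i : Fin n, α i.succ = p := by
  simp [multiIndices, Finset.mem_piAntidiag, Fin.sum_univ_succ]

theorem MemBeppoLevi.tangentialDeriv_spec {n p : ℕ} {F : PointSpace n → ℂ} (hF : MemBeppoLevi p F)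
    (k : Fin n → ℤ) {α : Fin (n + 1) → ℕ} (hα : α ∈ multiIndices n p) :
    ContDiff ℝ (α 0) (tangentialDeriv (fun i => α i.succ) (List.finRange n) F) ∧
      torusCoeff k (tangentialDeriv (fun i => α i.succ) (List.finRange n) F) =
        fun t => (∏ i, (Complex.I * k i) ^ α i.succ) * torusCoeff k F t := by
  have := _root_.tangentialDeriv_spec (r := α 0) k (fun i => α i.succ) (List.finRange n) (F := F)
    (by rw [← Fin.sum_univ_def, mem_multiIndices.mp hα]; exact hF.contDiff) hF.periodic
  rw [← Fin.prod_univ_def] at this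
  exact ⟨this.1, this.2.2⟩

theorem MemBeppoLevi.continuous_multiDeriv {n p : ℕ} {F : PointSpace n → ℂ}
    (hF : MemBeppoLevi p F) {α : Fin (n + 1) → ℕ} (hα : α ∈ multiIndices n p) :
    Continuous (multiDeriv α F) := by
  rw [multiDeriv_eq]
  exact (contDiff_iterate_partialDeriv (r := 0) 0 (a := α 0)
    (by simpa using (hF.tangentialDeriv_spec 0 hα).1)).continuous

theorem MemBeppoLevi.torusCoeff_multiDeriv {n p : ℕ} {F : PointSpace n → ℂ}
    (hF : MemBeppoLevi p F) (k : Fin n → ℤ) {α : Fin (n + 1) → ℕ} (hα : α ∈ multiIndices n p)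
    (t : ℝ) : torusCoeff k (multiDeriv α F) t =
      (∏ i, (Complex.I * k i) ^ α i.succ) * iteratedDeriv (α 0) (torusCoeff k F) t := by
  obtain ⟨h1, h2⟩ := hF.tangentialDeriv_spec k hα
  rw [multiDeriv_eq, torusCoeff_iterate_partialDeriv_zero k h1, h2, iteratedDeriv_const_mul_field]

theorem iteratedDeriv_conj (j : ℕ) (g : ℝ → ℂ) :
    iteratedDeriv j (fun t => (starRingEnd ℂ) (g t)) =
      fun t => (starRingEnd ℂ) (iteratedDeriv j g t) := by
  induction j generalizing g with
  | zero => simp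
  | succ j ih =>
    rw [iteratedDeriv_succ', iteratedDeriv_succ', ← ih]
    congr 1
    exact deriv.star'

/-- The squared Euclidean length of the frequency `k`. -/
noncomputable def freqSq {n : ℕ} (k : Fin n → ℤ) : ℂ := ∑ i, (k i : ℂ) ^ 2

theorem energyDensity_eq_sum_multiIndices {n : ℕ} (k : Fin n → ℤ) (p : ℕ) (f g : ℝ → ℂ) (t : ℝ) :
    energyDensity (freqSq k) p f g t = ∑ α ∈ multiIndices n p,
      ((p.factorial : ℂ) / ((∏ i, (α i).factorial : ℕ) : ℂ)) *
        ((∏ i, ((k i : ℂ) ^ 2) ^ α i.succ) *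
          (iteratedDeriv (α 0) f t * iteratedDeriv (α 0) g t)) := by
  -- The summands of `X + k₁² + ⋯ + kₙ²`; the exponent of `X` in a multinomial term records the
  -- order of the `t`-derivative.
  let v : Fin (n + 1) → Polynomial ℂ :=
    Fin.cons Polynomial.X fun i => Polynomial.C ((k i : ℂ) ^ 2)
  have hv : Polynomial.X + Polynomial.C (freqSq k) = ∑ i, v i := by
    rw [Fin.sum_univ_succ, freqSq, map_sum]
    simp [v]
  rw [energyDensity, hv, Finset.sum_pow_eq_sum_piAntidiag, map_sum]
  refine Finset.sum_congr rfl fun α hα => ?_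
  have hsum : ∑ i, α i = p := (Finset.mem_piAntidiag.mp hα).1
  have hm : ((Nat.multinomial Finset.univ α : ℕ) : ℂ) =
      (p.factorial : ℂ) / ((∏ i, (α i).factorial : ℕ) : ℂ) := by
    rw [eq_div_iff (by exact_mod_cast Finset.prod_ne_zero_iff.mpr fun i _ =>
      Nat.factorial_ne_zero _), mul_comm, ← hsum]
    exact_mod_cast Nat.multinomial_spec Finset.univ α
  have hp : ((Nat.multinomial Finset.univ α : ℕ) : Polynomial ℂ) * ∏ i, v i ^ α i =
      Polynomial.C (((Nat.multinomial Finset.univ α : ℕ) : ℂ) *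
        ∏ i, ((k i : ℂ) ^ 2) ^ α i.succ) * Polynomial.X ^ α 0 := by
    rw [Fin.prod_univ_succ, map_mul, map_prod]
    simp [v]
    ring
  rw [hp, momentFunctional.C_mul_X_pow, hm, mul_assoc]

/-- Each `I k_i` meets its conjugate, and their product is `k_i²`; the multinomial expansion does
the rest. -/
theorem MemBeppoLevi.sum_torusCoeff_multiDeriv {n p : ℕ} {F G : PointSpace n → ℂ}
    (hF : MemBeppoLevi p F) (hG : MemBeppoLevi p G) (k : Fin n → ℤ) (t : ℝ) :
    ∑ α ∈ multiIndices n p, ((p.factorial : ℂ) / ((∏ i, (α i).factorial : ℕ) : ℂ)) *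
      (torusCoeff k (multiDeriv α F) t * (starRingEnd ℂ) (torusCoeff k (multiDeriv α G) t)) =
    energyDensity (freqSq k) p (torusCoeff k F)
      (fun s => (starRingEnd ℂ) (torusCoeff k G s)) t := by
  rw [energyDensity_eq_sum_multiIndices]
  refine Finset.sum_congr rfl fun α hα => ?_
  rw [hF.torusCoeff_multiDeriv k hα, hG.torusCoeff_multiDeriv k hα, iteratedDeriv_conj]
  congr 1
  rw [map_mul, map_prod, mul_mul_mul_comm, ← Finset.prod_mul_distrib]
  congr 1
  refine Finset.prod_congr rfl fun i _ => ?_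
  rw [map_pow, ← mul_pow]
  congr 1
  simp only [map_mul, Complex.conj_I, map_intCast]
  linear_combination (-(k i : ℂ) ^ 2) * Complex.I_sq

/-! ### From polyharmonicity to an ordinary differential equation -/

theorem laplacian_eq_sum_partialDeriv {n : ℕ} {U : Set (PointSpace n)} (hU : IsOpen U)
    {F : PointSpace n → ℂ} (hF : ContDiffOn ℝ 2 F U) {x : PointSpace n} (hx : x ∈ U) :
    Laplacian.laplacian F x = ∑ i, partialDeriv i (partialDeriv i F) x := by
  rw [InnerProductSpace.laplacian_eq_iteratedFDeriv_orthonormalBasis F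
    (EuclideanSpace.basisFun (Fin (n + 1)) ℝ)]
  refine Finset.sum_congr rfl fun i _ => ?_
  have hd : DifferentiableAt ℝ (fderiv ℝ F) x :=
    ((hF.fderiv_of_isOpen hU (m := 1) (by norm_num)).differentiableOn
      (by norm_num)).differentiableAt (hU.mem_nhds hx)
  unfold partialDeriv
  rw [iteratedFDeriv_two_apply, fderiv_clm_apply hd (differentiableAt_const _)]
  simp

theorem ContDiffOn.laplacian {n r : ℕ} {U : Set (PointSpace n)} (hU : IsOpen U)
    {F : PointSpace n → ℂ} (hF : ContDiffOn ℝ (r + 2 : ℕ) F U) :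
    ContDiffOn ℝ r (Laplacian.laplacian F) U := by
  refine ContDiffOn.congr (f := fun x => ∑ i, _root_.partialDeriv i (_root_.partialDeriv i F) x)
    (ContDiffOn.sum fun i _ => ?_) fun x hx =>
      laplacian_eq_sum_partialDeriv hU (hF.of_le (by exact_mod_cast (by omega))) hx
  exact ContDiffOn.partialDeriv hU (ContDiffOn.partialDeriv (r := r + 1) hU hF i) i

theorem PeriodicInY.laplacian {n : ℕ} {F : PointSpace n → ℂ} (hF : PeriodicInY F) :
    PeriodicInY (Laplacian.laplacian F) := by
  intro j x
  have : (fun z => F (z + EuclideanSpace.single j.succ (2 * Real.pi))) = F := funext (hF j)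
  rw [InnerProductSpace.laplacian_eq_iteratedFDeriv_stdOrthonormalBasis]
  simp only [← iteratedFDeriv_comp_add_right, this]

theorem torusCoeff_congr {n : ℕ} (k : Fin n → ℤ) {F G : PointSpace n → ℂ} {I : Set ℝ}
    (h : Set.EqOn F G (slab n I)) {t : ℝ} (ht : t ∈ I) : torusCoeff k F t = torusCoeff k G t := by
  unfold torusCoeff
  congr 1
  ext y
  rw [h (show assemblePoint n (t, y) ∈ slab n I from ht)]

theorem integrable_torusCoeff {n : ℕ} (k : Fin n → ℤ) {F : PointSpace n → ℂ} {I : Set ℝ}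
    (h : ContinuousOn F (slab n I)) {t : ℝ} (ht : t ∈ I) :
    IntegrableOn (fun y => F (assemblePoint n (t, y)) * torusChar k y) (torusBox n) := by
  refine ContinuousOn.integrableOn_compact (isCompact_torusBox n) (ContinuousOn.mul ?_
    (contDiff_torusChar k (m := 0)).continuous.continuousOn)
  exact h.comp (f := fun y : Fin n → ℝ => assemblePoint n (t, y)) (by fun_prop) fun y _ => ht

theorem iteratedDeriv_two_torusCoeff {n : ℕ} (k : Fin n → ℤ) {F : PointSpace n → ℂ} {I : Set ℝ}
    (hI : IsOpen I) (hF : ContDiffOn ℝ 2 F (slab n I)) {t : ℝ} (ht : t ∈ I) :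
    iteratedDeriv 2 (torusCoeff k F) t =
      torusCoeff k (partialDeriv 0 (partialDeriv 0 F)) t := by
  have h1 : deriv (torusCoeff k F) =ᶠ[nhds t] torusCoeff k (partialDeriv 0 F) := by
    filter_upwards [hI.mem_nhds ht] with s hs
    exact (hasDerivAt_torusCoeff k hI (hF.of_le (by norm_num)) hs).deriv
  rw [iteratedDeriv_succ, iteratedDeriv_one, h1.deriv_eq]
  exact (hasDerivAt_torusCoeff k hI
    (ContDiffOn.partialDeriv (r := 1) (isOpen_slab hI) hF 0) ht).deriv

theorem torusCoeff_laplacian {n : ℕ} (k : Fin n → ℤ) {F : PointSpace n → ℂ} {I : Set ℝ}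
    (hI : IsOpen I) (hF : ContDiffOn ℝ 2 F (slab n I)) (hper : PeriodicInY F) {t : ℝ}
    (ht : t ∈ I) :
    torusCoeff k (Laplacian.laplacian F) t = helmholtz (freqSq k) (torusCoeff k F) t := by
  have hU := isOpen_slab (n := n) hI
  have h1 : ∀ i, ContDiffOn ℝ 1 (partialDeriv i F) (slab n I) := fun i =>
    ContDiffOn.partialDeriv (r := 1) hU hF i
  have h2 : ∀ i, ContinuousOn (partialDeriv i (partialDeriv i F)) (slab n I) := fun i =>
    (ContDiffOn.partialDeriv (r := 0) hU (by simpa using h1 i) i).continuousOn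
  rw [torusCoeff_congr k (fun x hx => laplacian_eq_sum_partialDeriv hU hF hx) ht]
  have hsum : torusCoeff k (fun x => ∑ i, partialDeriv i (partialDeriv i F) x) t =
      ∑ i, torusCoeff k (partialDeriv i (partialDeriv i F)) t := by
    simp only [torusCoeff, Finset.sum_mul]
    exact integral_finsetSum _ fun i _ => integrable_torusCoeff k (h2 i) ht
  rw [hsum, Fin.sum_univ_succ, helmholtz, iteratedDeriv_two_torusCoeff k hI hF ht, sub_eq_add_neg,
    freqSq, Finset.sum_mul, ← Finset.sum_neg_distrib]
  congr 1
  refine Finset.sum_congr rfl fun i _ => ?_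
  rw [torusCoeff_partialDeriv_succ k hI (h1 i.succ) (hper.partialDeriv i.succ) ht,
    torusCoeff_partialDeriv_succ k hI (hF.of_le (by norm_num)) hper ht]
  linear_combination ((k i : ℂ) ^ 2 * torusCoeff k F t) * Complex.I_sq

theorem iterate_laplacian_spec {n r q : ℕ} (k : Fin n → ℤ) {F : PointSpace n → ℂ} {I : Set ℝ}
    (hI : IsOpen I) (hF : ContDiffOn ℝ (r + 2 * q : ℕ) F (slab n I)) (hper : PeriodicInY F) :
    ContDiffOn ℝ r (Laplacian.laplacian^[q] F) (slab n I) ∧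
      PeriodicInY (Laplacian.laplacian^[q] F) ∧
      Set.EqOn ((helmholtz (freqSq k))^[q] (torusCoeff k F))
        (torusCoeff k (Laplacian.laplacian^[q] F)) I := by
  induction q generalizing r with
  | zero => exact ⟨by simpa using hF, hper, fun t _ => rfl⟩
  | succ q ih =>
    obtain ⟨h1, h2, h3⟩ := ih (r := r + 2) (by convert hF using 2; ring)
    rw [Function.iterate_succ_apply', Function.iterate_succ_apply']
    refine ⟨ContDiffOn.laplacian (isOpen_slab hI) h1, h2.laplacian, fun t ht => ?_⟩
    rw [torusCoeff_laplacian k hI (h1.of_le (by exact_mod_cast (by omega))) h2 ht]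
    have : (helmholtz (freqSq k))^[q] (torusCoeff k F) =ᶠ[nhds t]
        torusCoeff k (Laplacian.laplacian^[q] F) := by
      filter_upwards [hI.mem_nhds ht] with s hs using h3 hs
    rw [helmholtz, helmholtz, this.iteratedDeriv_eq, h3 ht]

/-- The interval of first coordinates of the strip `Ω_j`. -/
def stripInterval {N : ℕ} (t : Fin (N + 1) → ℝ) (j : Fin (N + 2)) : Set ℝ :=
  {s | ∀ i : Fin (N + 1), (i.castSucc < j → t i < s) ∧ (j ≤ i.castSucc → s < t i)}

theorem isOpen_stripInterval {N : ℕ} (t : Fin (N + 1) → ℝ) (j : Fin (N + 2)) :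
    IsOpen (stripInterval t j) := by
  simp only [stripInterval, Set.ofPred_forall, Set.ofPred_and]
  refine isOpen_iInter_of_finite fun i => IsOpen.inter ?_ ?_
  · exact isOpen_iInter_of_finite fun _ => isOpen_Ioi
  · exact isOpen_iInter_of_finite fun _ => isOpen_Iio

theorem exists_mem_stripInterval {N : ℕ} {t : Fin (N + 1) → ℝ} (ht : StrictMono t) {s : ℝ}
    (hs : ∀ i, s ≠ t i) : ∃ j, s ∈ stripInterval t j := by
  by_cases h : ∃ i, s < t i
  · obtain ⟨i₀, h₀⟩ := h
    have hne : (Finset.univ.filter fun i => s < t i).Nonempty := ⟨i₀, by simpa using h₀⟩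
    have hmin := Finset.min'_mem _ hne
    -- The strip is indexed by the first knot above `s`; past all knots it is the last one.
    refine ⟨((Finset.univ.filter fun i => s < t i).min' hne).castSucc, fun i => ⟨?_, ?_⟩⟩
    · intro hi
      rw [Fin.castSucc_lt_castSucc_iff] at hi
      by_contra hcon
      have hlt : s < t i := lt_of_le_of_ne (not_lt.mp hcon) (hs i)
      exact absurd (Finset.min'_le _ i (by simpa using hlt)) (not_le.mpr hi)
    · intro hi
      rw [Fin.castSucc_le_castSucc_iff] at hi
      exact (Finset.mem_filter.mp hmin).2.trans_le (ht.monotone hi)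
  · push Not at h
    refine ⟨Fin.last _, fun i => ⟨fun _ => lt_of_le_of_ne (h i) (hs i).symm, fun hi => ?_⟩⟩
    exact absurd hi (not_le.mpr (Fin.castSucc_lt_last i))

theorem IsBeppoLeviPolyspline.isExponentialSpline {n N q : ℕ} {t : Fin (N + 1) → ℝ}
    (ht : StrictMono t) {S : PointSpace n → ℂ} (hS : IsBeppoLeviPolyspline (q + 2) t S)
    (k : Fin n → ℤ) :
    IsExponentialSpline (freqSq k) q (Finset.univ.image t) (torusCoeff k S) := by
  refine ⟨contDiff_torusCoeff k (hS.contDiff.of_le (by exact_mod_cast (by omega))),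
    torusCoeff k (partialDeriv 0 (Laplacian.laplacian^[q + 1] S)), fun s hs => ?_⟩
  obtain ⟨j, hj⟩ := exists_mem_stripInterval ht (s := s) (fun i hi => hs (by simp [hi]))
  have hI := isOpen_stripInterval t j
  obtain ⟨h1, h2⟩ := hS.polyharmonic j
  change ContDiffOn ℝ _ S (slab n (stripInterval t j)) at h1
  -- Of the `2q + 4` derivatives available in the strip, `q + 1` Laplacians leave two: enough to
  -- differentiate the mode twice and to take the last Laplacian.
  obtain ⟨s1, s2, s3⟩ := iterate_laplacian_spec (r := 2) (q := q + 1) k hI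
    (by convert h1 using 2; ring) hS.periodic
  have e : (helmholtz (freqSq k))^[q + 1] (torusCoeff k S) =ᶠ[nhds s]
      torusCoeff k (Laplacian.laplacian^[q + 1] S) := by
    filter_upwards [hI.mem_nhds hj] with x hx using s3 hx
  refine ⟨(hasDerivAt_torusCoeff k hI (s1.of_le (by norm_num)) hj).congr_of_eventuallyEq e, ?_⟩
  refine (hasDerivAt_torusCoeff k hI
    (ContDiffOn.partialDeriv (r := 1) (isOpen_slab hI) s1 0) hj).congr_deriv ?_
  have h0 : torusCoeff k (Laplacian.laplacian (Laplacian.laplacian^[q + 1] S)) s = 0 := by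
    rw [torusCoeff_congr k (G := fun _ => 0) (I := stripInterval t j) (fun x hx => ?_) hj]
    · simp [torusCoeff]
    · have := h2 x hx
      rwa [Function.iterate_succ_apply'] at this
  rw [torusCoeff_laplacian k hI s1 s2 hj, helmholtz,
    iteratedDeriv_two_torusCoeff k hI s1 hj, sub_eq_zero] at h0
  rw [h0, s3 hj]

/-! ### Parseval on the cube and on the cylinder -/

section Parseval

open scoped Pointwise

noncomputable local instance : MeasureSpace UnitAddCircle := ⟨AddCircle.haarAddCircle⟩

local instance : Measure.IsAddHaarMeasure (volume : Measure UnitAddCircle) :=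
  inferInstanceAs (Measure.IsAddHaarMeasure AddCircle.haarAddCircle)

local instance : IsProbabilityMeasure (volume : Measure UnitAddCircle) :=
  inferInstanceAs (IsProbabilityMeasure AddCircle.haarAddCircle)

/-- The representative in `(-π, π]ⁿ` of a point of the unit torus `(ℝ / ℤ)ⁿ`, rescaled by `2π`. -/
noncomputable def torusLift {n : ℕ} (z : UnitAddTorus (Fin n)) : Fin n → ℝ :=
  (2 * Real.pi) • (UnitAddTorus.measurableEquivPiIoc (fun _ : Fin n => -(1 / 2 : ℝ)) z).1

theorem measurable_torusLift {n : ℕ} : Measurable (torusLift (n := n)) :=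
  (measurable_subtype_coe.comp (UnitAddTorus.measurableEquivPiIoc
    (fun _ : Fin n => -(1 / 2 : ℝ))).measurable).const_smul (2 * Real.pi)

theorem torusLift_mem {n : ℕ} (z : UnitAddTorus (Fin n)) : torusLift z ∈ torusBox n := by
  have h := (UnitAddTorus.measurableEquivPiIoc (fun _ : Fin n => -(1 / 2 : ℝ)) z).2
  have hpi := Real.pi_pos
  refine ⟨fun i => ?_, fun i => ?_⟩ <;> have hi := h i <;>
    simp only [torusLift, Pi.smul_apply, smul_eq_mul] <;> nlinarith [hi.1, hi.2]

/-- The circles carry total mass one, so rescaling to side `2π` produces `(2π)ⁿ`; the half-open and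
closed cubes differ by a null set. -/
theorem integral_torusLift {n : ℕ} (φ : (Fin n → ℝ) → ℂ) :
    ((2 * Real.pi : ℝ) : ℂ) ^ n * ∫ z : UnitAddTorus (Fin n), φ (torusLift z) =
      ∫ y in torusBox n, φ y := by
  have hpi := Real.pi_pos
  rw [UnitAddTorus.integral_preimage _ (fun _ : Fin n => -(1 / 2 : ℝ))]
  have hset : {x : Fin n → ℝ | ∀ i, x i ∈ Set.Ioc (-(1 / 2 : ℝ)) (-(1 / 2) + 1)} =
      Set.univ.pi fun _ => Set.Ioc (-(1 / 2 : ℝ)) (1 / 2) := by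
    ext x
    simp only [Set.mem_univ_pi, Set.mem_ofPred_eq]
    norm_num
  have hm : MeasurableSet (Set.univ.pi fun _ : Fin n => Set.Ioc (-(1 / 2 : ℝ)) (1 / 2)) :=
    MeasurableSet.univ_pi fun _ => measurableSet_Ioc
  rw [hset]
  have h1 : ∫ x in Set.univ.pi fun _ : Fin n => Set.Ioc (-(1 / 2 : ℝ)) (1 / 2),
      φ (torusLift fun i => (x i : UnitAddCircle)) =
      ∫ x in Set.univ.pi fun _ : Fin n => Set.Ioc (-(1 / 2 : ℝ)) (1 / 2),
        φ ((2 * Real.pi) • x) := by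
    refine setIntegral_congr_fun hm fun x hx => ?_
    have hx' : ∀ i, x i ∈ Set.Ioc (-(1 / 2 : ℝ)) (-(1 / 2) + 1) := by
      rw [← hset] at hx; exact hx
    have := (UnitAddTorus.measurableEquivPiIoc (fun _ : Fin n => -(1 / 2 : ℝ))).apply_symm_apply
      ⟨x, hx'⟩
    rw [UnitAddTorus.coe_symm_measurableEquivPiIoc_apply] at this
    simp only [torusLift, this]
  rw [h1, Measure.setIntegral_comp_smul volume φ _ (by positivity : (2 * Real.pi) ≠ 0)]
  have h2 : (2 * Real.pi) • (Set.univ.pi fun _ : Fin n => Set.Ioc (-(1 / 2 : ℝ)) (1 / 2)) =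
      Set.univ.pi fun _ : Fin n => Set.Ioc (-Real.pi) Real.pi := by
    rw [Set.smul_set_univ_pi]
    congr 1
    ext1 i
    simp only [Pi.smul_apply]
    rw [LinearOrderedField.smul_Ioc (by positivity : 0 < 2 * Real.pi)]
    congr 1 <;> ring
  rw [h2, Module.finrank_fin_fun, abs_of_nonneg (by positivity), Complex.real_smul, ← mul_assoc,
    torusBox]
  have h3 : ((2 * Real.pi : ℝ) : ℂ) ^ n * ((((2 * Real.pi) ^ n)⁻¹ : ℝ) : ℂ) = 1 := by
    push_cast
    exact mul_inv_cancel₀ (by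
      have : (Real.pi : ℂ) ≠ 0 := by exact_mod_cast hpi.ne'
      exact pow_ne_zero n (mul_ne_zero two_ne_zero this))
  rw [h3, one_mul]
  exact setIntegral_congr_set Measure.univ_pi_Ioc_ae_eq_Icc

theorem mFourier_neg_eq_torusChar {n : ℕ} (k : Fin n → ℤ) (z : UnitAddTorus (Fin n)) :
    UnitAddTorus.mFourier (-k) z = torusChar k (torusLift z) := by
  have hz : z = fun i => (((UnitAddTorus.measurableEquivPiIoc
      (fun _ : Fin n => -(1 / 2 : ℝ)) z).1 i : ℝ) : UnitAddCircle) := by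
    rw [← UnitAddTorus.coe_symm_measurableEquivPiIoc_apply, MeasurableEquiv.symm_apply_apply]
  have h1 : UnitAddTorus.mFourier (-k) z = ∏ i, fourier ((-k) i) (z i) := rfl
  rw [h1]
  conv_lhs => rw [hz]
  simp only [fourier_coe_apply, ← Complex.exp_sum, torusChar, torusLift]
  congr 1
  rw [Finset.mul_sum, ← Finset.sum_neg_distrib]
  refine Finset.sum_congr rfl fun i _ => ?_
  simp only [Pi.neg_apply, Pi.smul_apply, smul_eq_mul]
  push_cast
  ring

theorem memLp_comp_torusLift {n : ℕ} {f : (Fin n → ℝ) → ℂ} (hf : Continuous f) :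
    MemLp (fun z => f (torusLift z)) 2 (volume : Measure (UnitAddTorus (Fin n))) := by
  obtain ⟨C, hC⟩ := (isCompact_torusBox n).exists_bound_of_continuousOn hf.continuousOn
  exact MemLp.of_bound (hf.measurable.comp measurable_torusLift).aestronglyMeasurable C
    (Filter.Eventually.of_forall fun z => hC _ (torusLift_mem z))

theorem mFourierCoeff_comp_torusLift {n : ℕ} {f : (Fin n → ℝ) → ℂ} (hf : Continuous f)
    (k : Fin n → ℤ) :
    ((2 * Real.pi : ℝ) : ℂ) ^ n *
        UnitAddTorus.mFourierCoeff ((memLp_comp_torusLift hf).toLp _) k =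
      ∫ y in torusBox n, f y * torusChar k y := by
  rw [← integral_torusLift, UnitAddTorus.mFourierCoeff]
  congr 1
  refine integral_congr_ae ?_
  filter_upwards [(memLp_comp_torusLift hf).coeFn_toLp] with z hz
  rw [hz, mFourier_neg_eq_torusChar, smul_eq_mul, mul_comm]

/-- Parseval's identity on the cube `[-π, π]ⁿ`. -/
theorem hasSum_torusBox_parseval {n : ℕ} {f g : (Fin n → ℝ) → ℂ} (hf : Continuous f)
    (hg : Continuous g) :
    HasSum (fun k : Fin n → ℤ => (∫ y in torusBox n, f y * torusChar k y) *
        (starRingEnd ℂ) (∫ y in torusBox n, g y * torusChar k y))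
      (((2 * Real.pi : ℝ) : ℂ) ^ n * ∫ y in torusBox n, f y * (starRingEnd ℂ) (g y)) := by
  have h := UnitAddTorus.hasSum_prod_mFourierCoeff ((memLp_comp_torusLift hg).toLp _)
    ((memLp_comp_torusLift hf).toLp _)
  -- One factor `(2π)ⁿ` for each of the two coefficients; one of them is absorbed in the integral
  -- over the cube.
  have h' := h.mul_left ((((2 * Real.pi : ℝ) : ℂ) ^ n) * (((2 * Real.pi : ℝ) : ℂ) ^ n))
  have e1 : ∫ z, (starRingEnd ℂ) ((memLp_comp_torusLift hg).toLp _ z) *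
      (memLp_comp_torusLift hf).toLp _ z =
      ∫ z : UnitAddTorus (Fin n), f (torusLift z) * (starRingEnd ℂ) (g (torusLift z)) := by
    refine integral_congr_ae ?_
    filter_upwards [(memLp_comp_torusLift hf).coeFn_toLp, (memLp_comp_torusLift hg).coeFn_toLp]
      with z h1 h2
    rw [h1, h2, mul_comm]
  rw [e1, mul_assoc, integral_torusLift (fun y => f y * (starRingEnd ℂ) (g y))] at h'
  refine h'.congr_fun fun k => ?_
  rw [← mFourierCoeff_comp_torusLift hf, ← mFourierCoeff_comp_torusLift hg]
  simp only [map_mul, map_pow, Complex.conj_ofReal]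
  ring

end Parseval

theorem measurePreserving_assemblePoint (n : ℕ) :
    MeasurePreserving (assemblePoint n) (volume.prod (volume.restrict (torusBox n)))
      (volume.restrict (torusCylinder n)) := by
  have h : MeasurePreserving (assemblePoint n) volume volume := by
    have h1 := (volume_preserving_piFinSuccAbove (fun _ : Fin (n + 1) => ℝ) 0).symm
    have h2 := (PiLp.volume_preserving_toLp (Fin (n + 1))).comp h1
    have he : ⇑(assemblePoint n) = WithLp.toLp 2 ∘
        ⇑(MeasurableEquiv.piFinSuccAbove (fun _ : Fin (n + 1) => ℝ) 0).symm := by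
      funext z
      ext j
      refine Fin.cases ?_ (fun i => ?_) j <;> simp [MeasurableEquiv.piFinSuccAbove]
    rw [he]
    exact h2
  have hm : MeasurableSet (torusCylinder n) := by
    have : torusCylinder n = ⋂ i : Fin n, (fun x : PointSpace n => x i.succ) ⁻¹'
        Set.Icc (-Real.pi) Real.pi := by
      ext x; simp [torusCylinder]
    rw [this]
    exact MeasurableSet.iInter fun i => measurableSet_Icc.preimage
      (by fun_prop : Continuous fun x : PointSpace n => x i.succ).measurable
  have hpre : assemblePoint n ⁻¹' torusCylinder n = Set.univ ×ˢ torusBox n := by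
    ext z
    simp [torusCylinder, torusBox, Pi.le_def, forall_and]
  have := h.restrict_preimage hm
  rwa [hpre, Measure.volume_eq_prod, ← Measure.prod_restrict, Measure.restrict_univ] at this

theorem MeasureTheory.MemLp.integrable_mul_conj {α : Type*} [MeasurableSpace α] {μ : Measure α}
    {f g : α → ℂ} (hf : MemLp f 2 μ) (hg : MemLp g 2 μ) :
    Integrable (fun x => f x * (starRingEnd ℂ) (g x)) μ :=
  hf.integrable_mul hg.star

theorem integral_torusCylinder {n : ℕ} {φ : PointSpace n → ℂ}
    (hφ : IntegrableOn φ (torusCylinder n)) :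
    ∫ x in torusCylinder n, φ x = ∫ t, ∫ y in torusBox n, φ (assemblePoint n (t, y)) := by
  have h := measurePreserving_assemblePoint n
  have hi := hφ
  rw [IntegrableOn, ← h.map_eq] at hi
  rw [← h.map_eq, integral_map h.measurable.aemeasurable hi.1]
  exact integral_prod _ (h.integrable_comp_of_integrable hφ)

theorem integrable_integral_torusBox_norm_sq {n : ℕ} {A : PointSpace n → ℂ}
    (hA : MemLp A 2 (volume.restrict (torusCylinder n))) :
    Integrable fun t => ∫ y in torusBox n, ‖A (assemblePoint n (t, y))‖ ^ 2 :=
  ((hA.comp_measurePreserving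
    (measurePreserving_assemblePoint n)).integrable_norm_pow (by norm_num)).integral_prod_left

theorem hasSum_norm_sq_torusCoeff {n : ℕ} {A : PointSpace n → ℂ} (hA : Continuous A) (t : ℝ) :
    HasSum (fun k : Fin n → ℤ => ‖torusCoeff k A t‖ ^ 2)
      ((2 * Real.pi) ^ n * ∫ y in torusBox n, ‖A (assemblePoint n (t, y))‖ ^ 2) := by
  have hc : Continuous fun y => A (assemblePoint n (t, y)) := by fun_prop
  have h := hasSum_torusBox_parseval hc hc
  rw [← Complex.hasSum_ofReal]
  simp only [Complex.mul_conj'] at h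
  push_cast at h ⊢
  rw [← integral_complex_ofReal]
  push_cast
  exact h

/-- By Parseval on each slice, a single `|coefficient|²` is at most `(2π)ⁿ` times the slice integral
of `|A|²`, which is integrable in `t`. -/
theorem memLp_torusCoeff {n : ℕ} {A : PointSpace n → ℂ} (hA : Continuous A)
    (hA2 : MemLp A 2 (volume.restrict (torusCylinder n))) (k : Fin n → ℤ) :
    MemLp (torusCoeff k A) 2 := by
  have hm := (continuous_torusCoeff k hA).aestronglyMeasurable (μ := volume)
  rw [memLp_two_iff_integrable_sq_norm hm]
  refine ((integrable_integral_torusBox_norm_sq hA2).const_mul ((2 * Real.pi) ^ n)).mono'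
    (hm.norm.pow 2) (Filter.Eventually.of_forall fun t => ?_)
  rw [Real.norm_of_nonneg (by positivity)]
  exact le_hasSum (hasSum_norm_sq_torusCoeff hA t) k fun _ _ => by positivity

/-- Parseval's identity on the cylinder `ℝ × 𝕋ⁿ`. -/
theorem hasSum_torusCylinder_parseval {n : ℕ} {A B : PointSpace n → ℂ} (hA : Continuous A)
    (hB : Continuous B) (hA2 : MemLp A 2 (volume.restrict (torusCylinder n)))
    (hB2 : MemLp B 2 (volume.restrict (torusCylinder n))) :
    HasSum (fun k : Fin n → ℤ => ∫ t, torusCoeff k A t * (starRingEnd ℂ) (torusCoeff k B t))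
      (((2 * Real.pi : ℝ) : ℂ) ^ n *
        ∫ x in torusCylinder n, A x * (starRingEnd ℂ) (B x)) := by
  rw [integral_torusCylinder (hA2.integrable_mul_conj hB2), ← integral_const_mul]
  have hs : ∀ t, HasSum
      (fun k : Fin n → ℤ => ‖torusCoeff k A t‖ ^ 2 + ‖torusCoeff k B t‖ ^ 2) _ := fun t =>
    (hasSum_norm_sq_torusCoeff hA t).add (hasSum_norm_sq_torusCoeff hB t)
  -- The majorants sum over `k`, again by Parseval, to an integrable function of `t`; this justifies
  -- exchanging sum and integral.
  refine hasSum_integral_of_dominated_convergence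
    (fun k t => ‖torusCoeff k A t‖ ^ 2 + ‖torusCoeff k B t‖ ^ 2) (fun k => ?_) (fun k => ?_) ?_ ?_ ?_
  · exact ((continuous_torusCoeff k hA).mul
      (Complex.continuous_conj.comp (continuous_torusCoeff k hB))).aestronglyMeasurable
  · refine Filter.Eventually.of_forall fun t => ?_
    rw [norm_mul, RCLike.norm_conj]
    nlinarith [sq_nonneg (‖torusCoeff k A t‖ - ‖torusCoeff k B t‖),
      sq_nonneg ‖torusCoeff k A t‖, sq_nonneg ‖torusCoeff k B t‖]
  · exact Filter.Eventually.of_forall fun t => (hs t).summable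
  · simp only [(hs _).tsum_eq]
    exact ((integrable_integral_torusBox_norm_sq hA2).const_mul _).add
      ((integrable_integral_torusBox_norm_sq hB2).const_mul _)
  · refine Filter.Eventually.of_forall fun t => ?_
    exact hasSum_torusBox_parseval (f := fun y => A (assemblePoint n (t, y)))
      (g := fun y => B (assemblePoint n (t, y))) (by fun_prop) (by fun_prop)

/-- Parseval on the cylinder for each `∂^α`, after which the finite sum over `α` is regrouped
frequency by frequency. -/
theorem MemBeppoLevi.hasSum_inner {n p : ℕ} {F G : PointSpace n → ℂ} (hF : MemBeppoLevi p F)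
    (hG : MemBeppoLevi p G) :
    HasSum (fun k : Fin n → ℤ => ∫ t, energyDensity (freqSq k) p (torusCoeff k F)
        (fun s => (starRingEnd ℂ) (torusCoeff k G s)) t)
      (((2 * Real.pi : ℝ) : ℂ) ^ n * beppoLeviInner p F G) := by
  have h := hasSum_sum (s := multiIndices n p) fun α hα =>
    (hasSum_torusCylinder_parseval (hF.continuous_multiDeriv hα) (hG.continuous_multiDeriv hα)
      (hF.memLp α hα) (hG.memLp α hα)).mul_left
      ((p.factorial : ℂ) / ((∏ i, (α i).factorial : ℕ) : ℂ))
  have e1 : beppoLeviInner p F G = ∑ α ∈ multiIndices n p,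
      ((p.factorial : ℂ) / ((∏ i, (α i).factorial : ℕ) : ℂ)) *
        ∫ x in torusCylinder n, multiDeriv α F x * (starRingEnd ℂ) (multiDeriv α G x) := by
    unfold beppoLeviInner beppoLeviIntegrand
    rw [integral_finsetSum _ fun α hα =>
      ((hF.memLp α hα).integrable_mul_conj (hG.memLp α hα)).const_mul _]
    exact Finset.sum_congr rfl fun α _ => integral_const_mul _ _
  have e2 : ∀ k : Fin n → ℤ, ∫ t, energyDensity (freqSq k) p (torusCoeff k F)
      (fun s => (starRingEnd ℂ) (torusCoeff k G s)) t = ∑ α ∈ multiIndices n p,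
      ((p.factorial : ℂ) / ((∏ i, (α i).factorial : ℕ) : ℂ)) *
        ∫ t, torusCoeff k (multiDeriv α F) t *
          (starRingEnd ℂ) (torusCoeff k (multiDeriv α G) t) := by
    intro k
    simp only [← hF.sum_torusCoeff_multiDeriv hG k]
    rw [integral_finsetSum _ fun α hα =>
      ((memLp_torusCoeff (hF.continuous_multiDeriv hα) (hF.memLp α hα) k).integrable_mul_conj
        (memLp_torusCoeff (hG.continuous_multiDeriv hα) (hG.memLp α hα) k)).const_mul _]
    exact Finset.sum_congr rfl fun α _ => integral_const_mul _ _
  simp only [e2]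
  rw [e1, Finset.mul_sum]
  simpa only [mul_left_comm] using h

/-! ### Integrability of the modes and conclusion -/

theorem MemBeppoLevi.memLp_iteratedDeriv_top {n p : ℕ} {F : PointSpace n → ℂ}
    (hF : MemBeppoLevi p F) (k : Fin n → ℤ) : MemLp (iteratedDeriv p (torusCoeff k F)) 2 := by
  have hα : (Pi.single 0 p : Fin (n + 1) → ℕ) ∈ multiIndices n p := by
    simp [mem_multiIndices, Fin.succ_ne_zero]
  have h := memLp_torusCoeff (hF.continuous_multiDeriv hα) (hF.memLp _ hα) k
  rw [funext (hF.torusCoeff_multiDeriv k hα)] at h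
  simpa [Fin.succ_ne_zero] using h

theorem MemBeppoLevi.memLp_iteratedDeriv {n p : ℕ} {F : PointSpace n → ℂ}
    (hF : MemBeppoLevi p F) {k : Fin n → ℤ} (hk : k ≠ 0) {j : ℕ} (hj : j ≤ p) :
    MemLp (iteratedDeriv j (torusCoeff k F)) 2 := by
  obtain ⟨i, hi⟩ := Function.ne_iff.mp hk
  -- Choose `i` with `k_i ≠ 0` and put the remaining `p - j` derivatives on that variable: the
  -- symbol is then the nonzero constant `(I k_i)^{p-j}`, which can be divided out.
  have hα : (Fin.cons j (Pi.single i (p - j)) : Fin (n + 1) → ℕ) ∈ multiIndices n p := by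
    simp [mem_multiIndices, hj]
  have h := memLp_torusCoeff (hF.continuous_multiDeriv hα) (hF.memLp _ hα) k
  rw [funext (hF.torusCoeff_multiDeriv k hα)] at h
  have hprod : ∏ l, (Complex.I * k l) ^
      (Fin.cons j (Pi.single i (p - j)) : Fin (n + 1) → ℕ) l.succ =
      (Complex.I * k i) ^ (p - j) := by
    rw [Finset.prod_eq_single i]
    · simp
    · intro l _ hl; simp [hl]
    · simp
  rw [hprod] at h
  have hne : (Complex.I * k i) ^ (p - j) ≠ 0 :=
    pow_ne_zero _ (mul_ne_zero Complex.I_ne_zero (by exact_mod_cast hi))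
  have h' := h.const_mul ((Complex.I * k i) ^ (p - j))⁻¹
  refine h'.ae_eq (Filter.Eventually.of_forall fun t => ?_)
  simp only [Fin.cons_zero]
  rw [inv_mul_cancel_left₀ hne]

theorem mainTheorem3 (n p N : ℕ) (hn : 1 ≤ n) (hp : 2 ≤ p) (hpN : p ≤ N + 1)
    (t : Fin (N + 1) → ℝ) (ht : StrictMono t)
    (S : PointSpace n → ℂ) (hS : IsBeppoLeviPolyspline p t S)
    (G : PointSpace n → ℂ) (hG : MemBeppoLevi p G)
    (hG0 : ∀ j : Fin (N + 1), ∀ x ∈ torusCylinder n, x 0 = t j → G x = 0) :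
    beppoLeviInner p S G = 0 := by
  have hS' := hS.memBeppoLevi hp
  obtain ⟨q, rfl⟩ : ∃ q, p = q + 2 := ⟨p - 2, by omega⟩
  have hsum := hS'.hasSum_inner hG
  have hzero : ∀ k : Fin n → ℤ, ∫ s, energyDensity (freqSq k) (q + 2) (torusCoeff k S)
      (fun s => (starRingEnd ℂ) (torusCoeff k G s)) s = 0 := by
    intro k
    have hspline := hS.isExponentialSpline ht k
    have hg : ContDiff ℝ (q + 2 : ℕ) (fun s => (starRingEnd ℂ) (torusCoeff k G s)) :=
      Complex.conjCLE.contDiff.comp (contDiff_torusCoeff k hG.contDiff)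
    have hK : ∀ x ∈ Finset.univ.image t, (starRingEnd ℂ) (torusCoeff k G x) = 0 := by
      intro x hx
      obtain ⟨j, -, rfl⟩ := Finset.mem_image.mp hx
      have : torusCoeff k G (t j) = 0 := by
        refine setIntegral_eq_zero_of_forall_eq_zero fun y hy => ?_
        rw [hG0 j _ (fun i => ⟨hy.1 i, hy.2 i⟩) rfl, zero_mul]
      rw [this, map_zero]
    -- At `k = 0` the lower derivatives of the modes need not be in `L²`, so this frequency uses the
    -- separate polynomial argument.
    by_cases hk : k = 0
    · have hc : freqSq k = 0 := by simp [hk, freqSq]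
      rw [hc] at hspline ⊢
      exact hspline.integral_energyDensity_zero_of_memLp hg hK (hS'.memLp_iteratedDeriv_top k)
    · refine hspline.integral_energyDensity_of_memLp hg hK
        (fun j hj => hS'.memLp_iteratedDeriv hk hj) fun j hj => ?_
      rw [iteratedDeriv_conj]
      exact (hG.memLp_iteratedDeriv hk hj).star
  simp only [hzero] at hsum
  have hne : ((2 * Real.pi : ℝ) : ℂ) ^ n ≠ 0 :=
    pow_ne_zero _ (by exact_mod_cast Real.two_pi_pos.ne')
  exact (mul_eq_zero.mp (hsum.unique hasSum_zero)).resolve_left hne
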